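/- **Notation.** An r.i. space is a rearrangement invariant Banach function space on $(0,\infty)$ with Lebesgue measure, with the Fatou property (function norm in the sense of Bennett–Sharpley; $f^*\le g^*$ implies $\|f\|_E\le\|g\|_E$); its norm is extended by $\|f\|_E=\infty$ for measurable $f\notin E$. Put $\ell(t)=1+|\log t|$. For an r.i. space $E$ let $\widetilde E$ and $\widehat E$ be its versions over $((0,\infty),\frac{dt}{t})$ and $((0,\infty),\frac{dt}{t\,\ell(t)})$: if $E=(L_1,L_\infty)^K_D$, then $\widetilde E=(L_1(\frac{dt}t),L_\infty)^K_D$ and $\widehat E=(L_1(\frac{dt}{t\ell(t)}),L_\infty)^K_D$; equivalently, $\|f\|_{\widetilde E}$ and $\|f\|_{\widehat E}$ are the $E$-norms of the non-increasing rearrangement of $f$ with respect to $\frac{dt}{t}$ and $\frac{dt}{t\ell(t)}$, respectively. For an interval $I$, $\|f\|_{\widetilde E(I)}=\|f\chi_I\|_{\widetilde E}$. The fundamental function of $E$ is $\varphi_E(s)=\|\chi_{(0,s)}\|_E$. For functions on $(0,\infty)$, $f\sim g$ means that $C^{-1}g\le f\le Cg$ for some constant $C>0$. A positive (finite) measurable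 function $b$ on $(0,\infty)$ is slowly varying, $b\in SV$, if for each $\varepsilon>0$ the function $t^{\varepsilon}b(t)$ is equivalent to an increasing function and $t^{-\varepsilon}b(t)$ is equivalent to a decreasing function. The functions associated with $b$ are $B_0(u)=b(e^{1-1/u})$ and $B_\infty(u)=b(e^{1/u-1})$, $0<u\le1$, and likewise $A_0,A_\infty$ for $a$. For a positive function $\varphi$ on $(0,\alpha)$, $0<\alpha\le\infty$, let $m_\varphi(t)=\sup\{\varphi(ts)/\varphi(s): 0<s<\min\{\alpha,\alpha/t\}\}\in(0,\infty]$; the lower and upper extension indices of $\varphi$ are $$\pi_\varphi=\liminf_{t\to0}\frac{\ln m_\varphi(t)}{\ln t},\qquad \rho_\varphi=\limsup_{t\to\infty}\frac{\ln m_\varphi(t)}{\ln t}$$ (with $\ln\infty=\infty$; these are the usual limits whenever the limits exist). Here $\alpha=\infty$ for fundamental functions and $\alpha=1$ for associated functions. **Lemma.** Let $E,F,G$ be r.i. spaces and let $a,b\in SV$ with $a(t^2)\sim a(t)$ and $b(t^2)\sim b(t)$. 1. If $\rho_{A_\infty}<\pi_{\varphi_F}\le\rho_{\varphi_F}<\pi_{A_0}$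 and $\rho_{B_0}<0<\pi_{B_\infty}$, then $$\Big\|b(u)\,\|f\|_{\widetilde G(0,u)}\Big\|_{\widehat E}\sim\Big\|\frac{b(u)}{\|a\|_{\widetilde F(0,u)}}\,\big\|a(t)\,\|f\|_{\widetilde G(t,u)}\big\|_{\widetilde F(0,u)}\Big\|_{\widehat E}$$ for all measurable functions $f$ on $(0,\infty)$. 2. If $\rho_{A_0}<\pi_{\varphi_F}\le\rho_{\varphi_F}<\pi_{A_\infty}$ and $\rho_{B_\infty}<0<\pi_{B_0}$, then $$\Big\|b(u)\,\|f\|_{\widetilde G(u,\infty)}\Big\|_{\widehat E}\sim\Big\|\frac{b(u)}{\|a\|_{\widetilde F(u,\infty)}}\,\big\|a(t)\,\|f\|_{\widetilde G(u,t)}\big\|_{\widetilde F(u,\infty)}\Big\|_{\widehat E}$$ for all measurable functions $f$ on $(0,\infty)$. Here $X\sim Y$ means $C^{-1}Y\le X\le CY$ (as elements of $[0,\infty]$) with a constant $C\in(0,\infty)$ independent of $f$. -/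

import Mathlib

open MeasureTheory Set Filter Topology
open scoped ENNReal NNReal

noncomputable section

namespace RISpaces

/-- Lebesgue measure `dt` on the half-line `(0,∞)`. -/
def lebMeasure : Measure ℝ := volume.restrict (Ioi 0)

/-- The function `ℓ(t) = 1 + |log t|`. -/
def ell (t : ℝ) : ℝ := 1 + |Real.log t|

/-- The homogeneous measure `dt / t` on `(0,∞)`. -/
def tildeMeasure : Measure ℝ := lebMeasure.withDensity fun t => ENNReal.ofReal (1 / t)

/-- The measure `dt / (t ℓ(t))` on `(0,∞)`. -/
def hatMeasure : Measure ℝ := lebMeasure.withDensity fun t => ENNReal.ofReal (1 / (t * ell t))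

/-- The non-increasing rearrangement
`f*(t) = inf {s ≥ 0 : μ {x : f x > s} ≤ t}`, `t > 0`, of a non-negative function `f` with respect
to the measure `μ`. -/
def rearrangement (μ : Measure ℝ) (f : ℝ → ℝ≥0∞) (t : ℝ) : ℝ≥0∞ :=
  sInf {s : ℝ≥0∞ | μ {x | s < f x} ≤ ENNReal.ofReal t}

/-- A rearrangement invariant Banach function space on `(0,∞)` with Lebesgue measure and with the
Fatou property, given by its function norm `‖·‖` on the cone of (Lebesgue) measurable functions
with values in `[0,∞]`; the space consists of the measurable functions `f` with `‖ |f| ‖ < ∞`. -/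
structure RISpace where
  /-- the function norm -/
  norm : (ℝ → ℝ≥0∞) → ℝ≥0∞
  norm_eq_zero_iff : ∀ f, AEMeasurable f lebMeasure → (norm f = 0 ↔ f =ᵐ[lebMeasure] 0)
  norm_smul : ∀ (c : ℝ≥0) (f), AEMeasurable f lebMeasure →
    norm (fun t => (c : ℝ≥0∞) * f t) = (c : ℝ≥0∞) * norm f
  norm_add_le : ∀ f g, AEMeasurable f lebMeasure → AEMeasurable g lebMeasure →
    norm (fun t => f t + g t) ≤ norm f + norm g
  /-- Fatou property -/
  norm_iSup : ∀ f : ℕ → ℝ → ℝ≥0∞, (∀ n, AEMeasurable (f n) lebMeasure) → Monotone f →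
    norm (fun t => ⨆ n, f n t) = ⨆ n, norm (f n)
  norm_indicator_lt_top : ∀ S : Set ℝ, MeasurableSet S → lebMeasure S < ∞ →
    norm (S.indicator 1) < ∞
  lintegral_le : ∀ S : Set ℝ, MeasurableSet S → lebMeasure S < ∞ →
    ∃ C : ℝ≥0, ∀ f, AEMeasurable f lebMeasure → ∫⁻ t in S, f t ∂lebMeasure ≤ C * norm f
  /-- rearrangement invariance (and the lattice property) -/
  norm_le_of_rearrangement_le : ∀ f g, AEMeasurable f lebMeasure → AEMeasurable g lebMeasure →
    (∀ t > 0, rearrangement lebMeasure f t ≤ rearrangement lebMeasure g t) → norm f ≤ norm g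

/-- The norm of the version of `E` over the measure `μ`, that is `‖f‖ = ‖f*‖_E`, where `f*` is the
rearrangement of `f` with respect to `μ`. Since
`K(t, f; L₁(μ), L_∞(μ)) = ∫₀ᵗ f* = K(t, f*; L₁, L_∞)`, this is the norm of
`(L₁(μ), L_∞(μ))_D^K` for each parameter `D` with `E = (L₁, L_∞)_D^K`. -/
def RISpace.normOver (E : RISpace) (μ : Measure ℝ) (f : ℝ → ℝ≥0∞) : ℝ≥0∞ :=
  E.norm (rearrangement μ f)

/-- The norm of `Ẽ` restricted to the interval `I`: `‖f‖_{Ẽ(I)} = ‖f χ_I‖_{Ẽ}`, with respect to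
`dt / t`. -/
def RISpace.tildeNorm (E : RISpace) (I : Set ℝ) (f : ℝ → ℝ≥0∞) : ℝ≥0∞ :=
  E.normOver tildeMeasure (I.indicator f)

/-- The norm of `Ê`, with respect to `dt / (t ℓ(t))`. -/
def RISpace.hatNorm (E : RISpace) (f : ℝ → ℝ≥0∞) : ℝ≥0∞ :=
  E.normOver hatMeasure f

/-- The fundamental function `φ_E(s) = ‖χ_{(0,s)}‖_E`. -/
def RISpace.fundamental (E : RISpace) (s : ℝ) : ℝ≥0∞ := E.norm ((Ioo 0 s).indicator 1)

/-- The dilation function `m_φ(t) = sup φ(ts) / φ(s)` of a function `φ` on an interval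
`I = (0,α)`, `0 < α ≤ ∞`; the supremum is over all `s` with `s, ts ∈ I`, that is
`0 < s < min {α, α/t}`. -/
def dilation (I : Set ℝ) (φ : ℝ → ℝ≥0∞) (t : ℝ) : ℝ≥0∞ :=
  ⨆ s ∈ {s : ℝ | s ∈ I ∧ t * s ∈ I}, φ (t * s) / φ s

/-- The lower extension index `π_φ = lim_{t → 0} log m_φ(t) / log t`. The lower limit makes it
total: it is the limit whenever that exists, and a dilation function that takes the value `∞` at
points arbitrarily close to `0` gets `π_φ = -∞`. -/
def lowerIndex (I : Set ℝ) (φ : ℝ → ℝ≥0∞) : EReal :=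
  liminf (fun t : ℝ => ENNReal.log (dilation I φ t) / (Real.log t : EReal)) (𝓝[>] 0)

/-- The upper extension index `ρ_φ = lim_{t → ∞} log m_φ(t) / log t`. The upper limit makes it
total: it is the limit whenever that exists, and a dilation function that takes the value `∞` at
arbitrarily large points gets `ρ_φ = ∞`. -/
def upperIndex (I : Set ℝ) (φ : ℝ → ℝ≥0∞) : EReal :=
  limsup (fun t : ℝ => ENNReal.log (dilation I φ t) / (Real.log t : EReal)) atTop

/-- Equivalence `f ∼ g` of functions on `(0,∞)`. -/
def Equivalent (f g : ℝ → ℝ) : Prop :=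
  ∃ C : ℝ, 0 < C ∧ ∀ t > 0, f t ≤ C * g t ∧ g t ≤ C * f t

/-- Equivalent to an increasing function on `(0,∞)`. -/
def AlmostIncreasing (f : ℝ → ℝ) : Prop := ∃ g, MonotoneOn g (Ioi 0) ∧ Equivalent f g

/-- Equivalent to a decreasing function on `(0,∞)`. -/
def AlmostDecreasing (f : ℝ → ℝ) : Prop := ∃ g, AntitoneOn g (Ioi 0) ∧ Equivalent f g

/-- Slowly varying functions on `(0,∞)`: positive (finite) Lebesgue measurable functions `b` such
that, for each `ε > 0`, `t ^ ε b(t)` is almost increasing and `t ^ (-ε) b(t)` is almost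
decreasing. -/
structure SlowlyVarying (b : ℝ → ℝ) : Prop where
  aemeasurable : AEMeasurable b lebMeasure
  pos : ∀ t > 0, 0 < b t
  almostIncreasing : ∀ ε : ℝ, 0 < ε → AlmostIncreasing fun t => t ^ ε * b t
  almostDecreasing : ∀ ε : ℝ, 0 < ε → AlmostDecreasing fun t => t ^ (-ε) * b t

/-- The associated function `B_0(u) = b(e^{1 - 1/u})`, `0 < u ≤ 1`. -/
def assocZero (b : ℝ → ℝ) (u : ℝ) : ℝ≥0∞ := ENNReal.ofReal (b (Real.exp (1 - 1 / u)))

/-- The associated function `B_∞(u) = b(e^{1/u - 1})`, `0 < u ≤ 1`. -/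
def assocInfty (b : ℝ → ℝ) (u : ℝ) : ℝ≥0∞ := ENNReal.ofReal (b (Real.exp (1 / u - 1)))

end RISpaces

end

/-! In the coordinate y with u = `hatParam y`, the measure du/(u ℓ(u)) becomes Lebesgue measure dy
on the line, and dt/t becomes dx under t = e^x. Dilating the argument of B_0 or B_∞ amounts to
translating y. The index conditions on b therefore say that b decays exponentially in y, and for a
suitable κ > 0 the translation by κ at least halves it: b(y) ≤ b(y - κ)/2 (`exists_shift_le`).

Let W(u) be the norm of a over (0,u). It is finite because ρ_{φ_F} < π_{A_0} makes a dyadic series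
converge (`tailNorm_ne_top`). Since a(t²) ∼ a(t), W(u) and W(u²) are comparable, and so W grows by
at most a constant factor C under the translation by κ (`exists_tailNorm_shift_le`).

The averaged expression is at most the outer one pointwise, because the norm of f over (t,u) is at
most that over (0,u). Conversely, let v be u translated back by κ. For t < v the norm over (t,u)
dominates that over (v,u), whence b(u)‖f‖_{(v,u)} ≤ C h(u) with h the averaged expression
(`mul_tildeNorm_Ioo_le_averagedProfile`). Cutting (0,u) into successive pieces of length κ in y, and
using the halving of b, gives b(u)‖f‖_{(0,u)} ≤ C ∑ 2^{-k} h(y - kκ). Translations preserve dy, so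
the norm in E is at most 2C times that of h (`hatNorm_outerProfile_le`).

The function norm of E lives on the half-line. A measure preserving map of the half-line to the line
(`interleave`) transfers the triangle inequality and the Fatou property. The second equivalence is
the first one under t ↦ 1/t, which preserves both measures and exchanges A_0 with A_∞ and B_0 with
B_∞. -/

namespace RISpaces

/-! ### Rearrangements and distribution functions -/

/-- The infimum is attained: the distribution function is right continuous, since {s < f} is the
increasing union of {v n < f} for v n decreasing to s. -/
theorem rearrangement_le_iff (μ : Measure ℝ) (f : ℝ → ℝ≥0∞) (t : ℝ) (s : ℝ≥0∞) :
    rearrangement μ f t ≤ s ↔ μ {x | s < f x} ≤ ENNReal.ofReal t := by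
  refine ⟨fun h => ?_, fun h => sInf_le h⟩
  rcases eq_or_ne s ∞ with rfl | hs
  · simp
  obtain ⟨v, hv, hvs, hvt⟩ := exists_seq_strictAnti_tendsto' (show s < ∞ from hs.lt_top)
  have hU : {x | s < f x} = ⋃ n, {x | v n < f x} := by
    ext x
    simp only [mem_ofPred_eq, mem_iUnion]
    refine ⟨fun hx => (hvt.eventually_lt_const hx).exists, ?_⟩
    rintro ⟨n, hn⟩
    exact (hvs n).1.trans hn
  have hm : Monotone fun n => {x | v n < f x} :=
    fun m n hmn x (hx : v m < f x) => (hv.antitone hmn).trans_lt hx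
  rw [hU, hm.measure_iUnion]
  refine iSup_le fun n => ?_
  obtain ⟨r, hr, hrs⟩ := sInf_lt_iff.1 (lt_of_le_of_lt h (hvs n).1)
  exact (measure_mono fun x (hx : v n < f x) => hrs.trans hx).trans hr

theorem lt_rearrangement_iff (μ : Measure ℝ) (f : ℝ → ℝ≥0∞) (t : ℝ) (s : ℝ≥0∞) :
    s < rearrangement μ f t ↔ ENNReal.ofReal t < μ {x | s < f x} := by
  rw [← not_le, rearrangement_le_iff, not_le]

theorem rearrangement_antitone (μ : Measure ℝ) (f : ℝ → ℝ≥0∞) :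
    Antitone (rearrangement μ f) := fun _ _ h =>
  (rearrangement_le_iff ..).2 <|
    ((rearrangement_le_iff μ f _ _).1 le_rfl).trans (ENNReal.ofReal_le_ofReal h)

theorem volume_setOf_ofReal_lt (m : ℝ≥0∞) :
    volume {t : ℝ | 0 < t ∧ ENNReal.ofReal t < m} = m := by
  rcases eq_or_ne m ∞ with rfl | hm
  · have : {t : ℝ | 0 < t ∧ ENNReal.ofReal t < ∞} = Ioi 0 := by ext; simp
    rw [this, Real.volume_Ioi]
  · have : {t : ℝ | 0 < t ∧ ENNReal.ofReal t < m} = Ioo 0 m.toReal := by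
      ext t
      simp only [mem_ofPred_eq, mem_Ioo, and_congr_right_iff]
      exact fun ht => ENNReal.ofReal_lt_iff_lt_toReal ht.le hm
    rw [this, Real.volume_Ioo, sub_zero, ENNReal.ofReal_toReal hm]

theorem lebMeasure_setOf_ofReal_lt (m : ℝ≥0∞) :
    lebMeasure {t : ℝ | ENNReal.ofReal t < m} = m := by
  rw [lebMeasure, Measure.restrict_apply' measurableSet_Ioi]
  convert volume_setOf_ofReal_lt m using 2
  ext t
  exact and_comm

/-- Equimeasurability of f and f*. It lets every later norm comparison be made on distribution
functions. -/
theorem lebMeasure_lt_rearrangement (μ : Measure ℝ) (f : ℝ → ℝ≥0∞) (s : ℝ≥0∞) :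
    lebMeasure {t | s < rearrangement μ f t} = μ {x | s < f x} := by
  simp only [lt_rearrangement_iff]
  exact lebMeasure_setOf_ofReal_lt _

theorem rearrangement_le_of_dist {μ ν : Measure ℝ} {f g : ℝ → ℝ≥0∞}
    (h : ∀ s, μ {x | s < f x} ≤ ν {x | s < g x}) (t : ℝ) :
    rearrangement μ f t ≤ rearrangement ν g t :=
  (rearrangement_le_iff ..).2 <| (h _).trans <| (rearrangement_le_iff ν g t _).1 le_rfl

theorem aemeasurable_rearrangement (μ ν : Measure ℝ) (f : ℝ → ℝ≥0∞) :
    AEMeasurable (rearrangement μ f) ν := (rearrangement_antitone μ f).measurable.aemeasurable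

/-! ### The norm of a rearrangement invariant space over a measure -/

namespace RISpace

variable (E : RISpace)

theorem normOver_le_of_dist {μ ν : Measure ℝ} {f g : ℝ → ℝ≥0∞}
    (h : ∀ s, μ {x | s < f x} ≤ ν {x | s < g x}) : E.normOver μ f ≤ E.normOver ν g := by
  refine E.norm_le_of_rearrangement_le _ _ (aemeasurable_rearrangement ..)
    (aemeasurable_rearrangement ..) fun t _ => rearrangement_le_of_dist (fun s => ?_) t
  rw [lebMeasure_lt_rearrangement, lebMeasure_lt_rearrangement]
  exact h s

theorem normOver_congr_dist {μ ν : Measure ℝ} {f g : ℝ → ℝ≥0∞}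
    (h : ∀ s, μ {x | s < f x} = ν {x | s < g x}) : E.normOver μ f = E.normOver ν g :=
  le_antisymm (E.normOver_le_of_dist fun s => (h s).le) (E.normOver_le_of_dist fun s => (h s).ge)

theorem normOver_mono_ae {μ : Measure ℝ} {f g : ℝ → ℝ≥0∞} (h : f ≤ᵐ[μ] g) :
    E.normOver μ f ≤ E.normOver μ g :=
  E.normOver_le_of_dist fun _ => measure_mono_ae <| by
    filter_upwards [h] with x hx using fun hs => lt_of_lt_of_le hs hx

theorem normOver_mono (μ : Measure ℝ) {f g : ℝ → ℝ≥0∞} (h : ∀ x, f x ≤ g x) :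
    E.normOver μ f ≤ E.normOver μ g := E.normOver_mono_ae (Eventually.of_forall h)

theorem normOver_congr_ae {μ : Measure ℝ} {f g : ℝ → ℝ≥0∞} (h : f =ᵐ[μ] g) :
    E.normOver μ f = E.normOver μ g :=
  le_antisymm (E.normOver_mono_ae h.le) (E.normOver_mono_ae h.symm.le)

theorem norm_eq_normOver {f : ℝ → ℝ≥0∞} (hf : AEMeasurable f lebMeasure) :
    E.norm f = E.normOver lebMeasure f := by
  have h := fun s => lebMeasure_lt_rearrangement lebMeasure f s
  exact le_antisymm
    (E.norm_le_of_rearrangement_le _ _ hf (aemeasurable_rearrangement ..) fun t _ =>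
      rearrangement_le_of_dist (fun s => (h s).ge) t)
    (E.norm_le_of_rearrangement_le _ _ (aemeasurable_rearrangement ..) hf fun t _ =>
      rearrangement_le_of_dist (fun s => (h s).le) t)

theorem normOver_comp {μ ν : Measure ℝ} {τ : ℝ → ℝ} (hτ : MeasurePreserving τ μ ν)
    {f : ℝ → ℝ≥0∞} (hf : AEMeasurable f ν) : E.normOver μ (fun x => f (τ x)) = E.normOver ν f :=
  E.normOver_congr_dist fun _ =>
    hτ.measure_preimage (nullMeasurableSet_lt aemeasurable_const hf)

theorem normOver_eq_norm_comp {μ : Measure ℝ} {τ : ℝ → ℝ} (hτ : MeasurePreserving τ lebMeasure μ)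
    {f : ℝ → ℝ≥0∞} (hf : AEMeasurable f μ) : E.normOver μ f = E.norm fun x => f (τ x) := by
  have hc : AEMeasurable (fun x => f (τ x)) lebMeasure :=
    hf.comp_quasiMeasurePreserving hτ.quasiMeasurePreserving
  rw [E.norm_eq_normOver hc, ← E.normOver_comp hτ hf]

end RISpace

/-- Measures that are images of Lebesgue measure on the half-line. -/
def LebesgueImage (μ : Measure ℝ) : Prop := ∃ τ : ℝ → ℝ, MeasurePreserving τ lebMeasure μ

namespace RISpace

variable (E : RISpace) {μ : Measure ℝ}

theorem normOver_add_le (hμ : LebesgueImage μ) {f g : ℝ → ℝ≥0∞} (hf : AEMeasurable f μ)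
    (hg : AEMeasurable g μ) :
    E.normOver μ (fun x => f x + g x) ≤ E.normOver μ f + E.normOver μ g := by
  obtain ⟨τ, hτ⟩ := hμ
  rw [E.normOver_eq_norm_comp hτ hf, E.normOver_eq_norm_comp hτ hg,
    E.normOver_eq_norm_comp hτ (f := fun x => f x + g x) (hf.add hg)]
  exact E.norm_add_le _ _ (hf.comp_quasiMeasurePreserving hτ.quasiMeasurePreserving)
    (hg.comp_quasiMeasurePreserving hτ.quasiMeasurePreserving)

theorem normOver_iSup (hμ : LebesgueImage μ) {f : ℕ → ℝ → ℝ≥0∞} (hf : ∀ n, AEMeasurable (f n) μ)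
    (hm : Monotone f) : E.normOver μ (fun x => ⨆ n, f n x) = ⨆ n, E.normOver μ (f n) := by
  obtain ⟨τ, hτ⟩ := hμ
  simp only [fun n => E.normOver_eq_norm_comp hτ (hf n)]
  rw [E.normOver_eq_norm_comp hτ (AEMeasurable.iSup hf)]
  exact E.norm_iSup (fun n x => f n (τ x))
    (fun n => (hf n).comp_quasiMeasurePreserving hτ.quasiMeasurePreserving)
    fun m n h x => hm h (τ x)

theorem normOver_const_mul (hμ : LebesgueImage μ) (c : ℝ≥0∞) {f : ℝ → ℝ≥0∞}
    (hf : AEMeasurable f μ) : E.normOver μ (fun x => c * f x) = c * E.normOver μ f := by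
  have key : ∀ c : ℝ≥0, E.normOver μ (fun x => (c : ℝ≥0∞) * f x) = c * E.normOver μ f := by
    intro c
    obtain ⟨τ, hτ⟩ := hμ
    rw [E.normOver_eq_norm_comp hτ hf, E.normOver_eq_norm_comp hτ (hf.const_mul _)]
    exact E.norm_smul c _ (hf.comp_quasiMeasurePreserving hτ.quasiMeasurePreserving)
  induction c with
  | coe c => exact key c
  | top =>
    -- The homogeneity axiom covers finite constants only; ∞ is reached as a supremum of integers by
    -- the Fatou property.
    have htop : (∞ : ℝ≥0∞) = ⨆ n : ℕ, ((n : ℝ≥0) : ℝ≥0∞) := by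
      simpa using ENNReal.iSup_natCast.symm
    have := E.normOver_iSup hμ (f := fun n x => ((n : ℝ≥0) : ℝ≥0∞) * f x)
      (fun n => hf.const_mul _) fun m n h x => by dsimp only; gcongr
    simp only [← ENNReal.iSup_mul, ← htop, key] at this
    exact this

/-- The triangle inequality for partial sums passes to the limit by the Fatou property. -/
theorem normOver_tsum_le (hμ : LebesgueImage μ) {f : ℕ → ℝ → ℝ≥0∞}
    (hf : ∀ n, AEMeasurable (f n) μ) :
    E.normOver μ (fun x => ∑' n, f n x) ≤ ∑' n, E.normOver μ (f n) := by
  have hzero : E.normOver μ (fun _ => 0) = 0 := by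
    simpa using E.normOver_const_mul hμ 0 (f := fun _ => 0) aemeasurable_const
  have hfin : ∀ n : ℕ, E.normOver μ (fun x => ∑ i ∈ Finset.range n, f i x) ≤
      ∑ i ∈ Finset.range n, E.normOver μ (f i) := by
    intro n
    induction n with
    | zero => simp [hzero]
    | succ n ih =>
      simp only [Finset.sum_range_succ]
      exact (E.normOver_add_le hμ (Finset.aemeasurable_fun_sum _ fun i _ => hf i) (hf n)).trans
        (by gcongr)
  simp only [ENNReal.tsum_eq_iSup_nat]
  rw [E.normOver_iSup hμ (fun n => Finset.aemeasurable_fun_sum _ fun i _ => hf i)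
    fun m n h x => Finset.sum_le_sum_of_subset (Finset.range_mono h)]
  exact iSup_mono hfin

theorem normOver_ne_zero (hμ : LebesgueImage μ) {f : ℝ → ℝ≥0∞} (hf : AEMeasurable f μ)
    (h : ¬ f =ᵐ[μ] 0) : E.normOver μ f ≠ 0 := by
  obtain ⟨τ, hτ⟩ := hμ
  rw [E.normOver_eq_norm_comp hτ hf]
  have hc : AEMeasurable (fun x => f (τ x)) lebMeasure :=
    hf.comp_quasiMeasurePreserving hτ.quasiMeasurePreserving
  rw [Ne, E.norm_eq_zero_iff _ hc]
  intro h0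
  apply h
  have hn : NullMeasurableSet {x | f x ≠ 0} μ := hf.nullMeasurableSet_preimage
    (measurableSet_singleton 0).compl
  have := hτ.measure_preimage hn
  rw [Filter.EventuallyEq, ae_iff]
  exact this.symm.trans (ae_iff.1 h0)

theorem normOver_indicator_le {S : Set ℝ} {r : ℝ} (h : μ S ≤ ENNReal.ofReal r) (c : ℝ≥0∞) :
    E.normOver μ (S.indicator fun _ => c) ≤ c * E.fundamental r := by
  have hleb : LebesgueImage lebMeasure := ⟨id, MeasurePreserving.id _⟩
  have hm : AEMeasurable ((Ioo 0 r).indicator (1 : ℝ → ℝ≥0∞)) lebMeasure :=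
    (measurable_one.indicator measurableSet_Ioo).aemeasurable
  rw [fundamental, E.norm_eq_normOver hm, ← E.normOver_const_mul hleb c hm]
  refine E.normOver_le_of_dist fun s => ?_
  by_cases hs : s < c
  · calc μ {x | s < S.indicator (fun _ => c) x} ≤ μ S := measure_mono fun x hx => by
          by_contra hxS
          simp [hxS] at hx
      _ ≤ ENNReal.ofReal r := h
      _ = lebMeasure (Ioo 0 r) := by
          rw [lebMeasure, Measure.restrict_apply measurableSet_Ioo,
            inter_eq_left.2 fun x hx => hx.1, Real.volume_Ioo, sub_zero]
      _ ≤ _ := measure_mono fun x hx => by simpa [hx] using hs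
  · have : {x | s < S.indicator (fun _ => c) x} = ∅ := by
      ext x
      by_cases hx : x ∈ S <;> simp_all
    simp [this]

theorem fundamental_lt_top (r : ℝ) : E.fundamental r < ∞ :=
  E.norm_indicator_lt_top _ measurableSet_Ioo <| by
    rw [lebMeasure, Measure.restrict_apply measurableSet_Ioo,
      inter_eq_left.2 fun x hx => hx.1, Real.volume_Ioo]
    exact ENNReal.ofReal_lt_top

theorem fundamental_ne_zero {r : ℝ} (hr : 0 < r) : E.fundamental r ≠ 0 := by
  have hm : AEMeasurable ((Ioo 0 r).indicator (1 : ℝ → ℝ≥0∞)) lebMeasure :=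
    (measurable_one.indicator measurableSet_Ioo).aemeasurable
  rw [fundamental, Ne, E.norm_eq_zero_iff _ hm]
  intro h
  have h0 : lebMeasure (Ioo 0 r) = 0 := measure_mono_null (fun x hx => by
    simpa using hx) (ae_iff.1 h)
  rw [lebMeasure, Measure.restrict_apply measurableSet_Ioo,
    inter_eq_left.2 fun x hx => hx.1, Real.volume_Ioo] at h0
  simp at h0
  linarith

end RISpace
/-! ### Measure preserving maps -/

/-- A map of `(0,∞)` onto the line that preserves Lebesgue measure up to null sets: it carries the
intervals `[n, n + 1)` with even and odd `n` to intervals to the right and to the left of `0`. -/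
noncomputable def interleave (x : ℝ) : ℝ :=
  if Even ⌊x⌋ then x - ⌊x⌋ + (⌊x⌋ / 2 : ℤ) else x - ⌊x⌋ - (⌊x⌋ / 2 + 1 : ℤ)

theorem floor_interleave (x : ℝ) :
    ⌊interleave x⌋ = if Even ⌊x⌋ then ⌊x⌋ / 2 else -(⌊x⌋ / 2 + 1) := by
  unfold interleave
  split_ifs
  · rw [Int.floor_add_intCast, Int.floor_sub_intCast]; omega
  · rw [Int.floor_sub_intCast, Int.floor_sub_intCast]; omega

theorem fract_interleave (x : ℝ) : Int.fract (interleave x) = Int.fract x := by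
  unfold interleave
  split_ifs
  · rw [Int.fract_add_intCast, Int.fract_sub_intCast]
  · rw [Int.fract_sub_intCast, Int.fract_sub_intCast]

/-- One-dimensional change of variables; it identifies all the measures below as images of Lebesgue
measure. -/
theorem map_withDensity_deriv {s : Set ℝ} (hs : NullMeasurableSet s volume) {g g' : ℝ → ℝ}
    (hg : ∀ x ∈ s, HasDerivAt g (g' x) x) (hg' : ∀ x ∈ s, 0 < g' x) (hinj : InjOn g s) :
    Measure.map g ((volume.restrict s).withDensity fun x => ENNReal.ofReal (g' x)) =
      volume.restrict (g '' s) := by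
  rw [← map_withDensity_abs_det_fderiv_eq_addHaar volume hs
    (fun x hx => (hg x hx).hasFDerivAt.hasFDerivWithinAt) hinj]
  congr 1
  refine withDensity_congr_ae ?_
  filter_upwards [ae_restrict_mem₀ hs] with x hx
  simp [abs_of_pos (hg' x hx)]

theorem measurePreserving_interleave : MeasurePreserving interleave lebMeasure volume := by
  have hmeas : Measurable interleave := by
    unfold interleave
    refine Measurable.ite ?_ (by fun_prop) (by fun_prop)
    exact Int.measurable_floor (MeasurableSet.of_discrete (s := {n : ℤ | Even n}))
  refine ⟨hmeas, ?_⟩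
  -- Off the null set of integers the map is locally a translation, hence has derivative 1.
  -- Injectivity and the image are read off from floor and fractional part.
  set Z : Set ℝ := range ((↑) : ℤ → ℝ) with hZ
  have hZ0 : volume Z = 0 := (countable_range _).measure_zero _
  have hZm : MeasurableSet Z := (countable_range _).measurableSet
  have hfr : ∀ x : ℝ, x ∈ Z ↔ Int.fract x = 0 := fun x => Int.fract_eq_zero_iff.symm
  have hleb : lebMeasure = volume.restrict (Ioi 0 \ Z) :=
    (Measure.restrict_congr_set (sdiff_null_ae_eq_self hZ0)).symm
  have himage : interleave '' (Ioi 0 \ Z) = univ \ Z := by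
    ext z
    simp only [mem_image, Set.mem_sdiff, mem_univ, true_and, hfr]
    constructor
    · rintro ⟨x, ⟨-, hx⟩, rfl⟩
      rwa [fract_interleave]
    · intro hz
      have hf0 := Int.fract_nonneg z
      have hf1 := Int.fract_lt_one z
      have hpos : 0 < Int.fract z := lt_of_le_of_ne hf0 (Ne.symm hz)
      obtain ⟨n, hn, hv⟩ : ∃ n : ℤ, 0 ≤ n ∧
          (if Even n then n / 2 else -(n / 2 + 1)) = ⌊z⌋ := by
        rcases le_or_gt 0 ⌊z⌋ with h | h
        · exact ⟨2 * ⌊z⌋, by omega, by simp⟩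
        · refine ⟨2 * (-⌊z⌋ - 1) + 1, by omega, ?_⟩
          rw [if_neg (by simp)]
          omega
      have hfl : ⌊(n : ℝ) + Int.fract z⌋ = n := by simp
      have hfr' : Int.fract ((n : ℝ) + Int.fract z) = Int.fract z := by simp
      have hn' : (0 : ℝ) ≤ n := by exact_mod_cast hn
      refine ⟨n + Int.fract z, ⟨by simp only [mem_Ioi]; linarith, by rwa [hfr']⟩, ?_⟩
      rw [← Int.floor_add_fract (interleave _), floor_interleave, fract_interleave, hfl, hfr', hv,
        Int.floor_add_fract]
  have hinj : InjOn interleave (Ioi 0 \ Z) := by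
    intro x hx y hy hxy
    have h1 := fract_interleave x
    rw [hxy, fract_interleave] at h1
    have h2 := floor_interleave x
    rw [hxy, floor_interleave] at h2
    have hx0 : 0 ≤ ⌊x⌋ := Int.floor_nonneg.2 (le_of_lt hx.1)
    have hy0 : 0 ≤ ⌊y⌋ := Int.floor_nonneg.2 (le_of_lt hy.1)
    have : ⌊x⌋ = ⌊y⌋ := by
      split_ifs at h2 with h3 h4 h4 <;> simp only [Int.even_iff] at h3 h4 <;> omega
    rw [← Int.floor_add_fract x, ← Int.floor_add_fract y, this, h1]
  have hder : ∀ x ∈ Ioi 0 \ Z, HasDerivAt interleave ((fun _ => 1 : ℝ → ℝ) x) x := by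
    intro x hx
    have hpos : 0 < Int.fract x :=
      lt_of_le_of_ne (Int.fract_nonneg x) fun h => hx.2 ((hfr x).2 h.symm)
    have hmem : Ioo (⌊x⌋ : ℝ) (⌊x⌋ + 1) ∈ 𝓝 x := by
      refine Ioo_mem_nhds ?_ (Int.lt_floor_add_one x)
      have := Int.floor_add_fract x
      linarith
    have hev : ∀ᶠ y in 𝓝 x, ⌊y⌋ = ⌊x⌋ := by
      filter_upwards [hmem] with y hy
      exact Int.floor_eq_iff.2 ⟨hy.1.le, hy.2⟩
    by_cases h : Even ⌊x⌋
    · have : interleave =ᶠ[𝓝 x] fun y => y - ⌊x⌋ + (⌊x⌋ / 2 : ℤ) := by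
        filter_upwards [hev] with y hy
        simp only [interleave, hy, if_pos h]
      exact (((hasDerivAt_id x).sub_const _).add_const _).congr_of_eventuallyEq this
    · have : interleave =ᶠ[𝓝 x] fun y => y - ⌊x⌋ - (⌊x⌋ / 2 + 1 : ℤ) := by
        filter_upwards [hev] with y hy
        simp only [interleave, hy, if_neg h]
      exact (((hasDerivAt_id x).sub_const _).sub_const _).congr_of_eventuallyEq this
  have := map_withDensity_deriv (measurableSet_Ioi.diff hZm).nullMeasurableSet hder
    (fun _ _ => one_pos) hinj
  rw [himage, Measure.restrict_congr_set (s := univ \ Z) (sdiff_null_ae_eq_self hZ0),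
    Measure.restrict_univ, ← hleb] at this
  simpa using this

/-! ### The measures dt/t and dt/(t ℓ(t)) as images of Lebesgue measure on the line -/

theorem tildeMeasure_eq : tildeMeasure = Measure.map Real.exp volume := by
  have h := map_withDensity_deriv (s := Ioi 0) measurableSet_Ioi.nullMeasurableSet
    (g := Real.log) (g' := fun t => 1 / t)
    (fun x hx => by simpa using Real.hasDerivAt_log (ne_of_gt hx))
    (fun x hx => one_div_pos.2 hx) Real.log_injOn_pos
  have himage : Real.log '' Ioi 0 = univ :=
    eq_univ_of_forall fun x => ⟨Real.exp x, Real.exp_pos x, Real.log_exp x⟩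
  rw [himage, Measure.restrict_univ] at h
  have h' : Measure.map Real.log tildeMeasure = volume := h
  rw [← h', Measure.map_map Real.measurable_exp Real.measurable_log]
  have hae : Real.exp ∘ Real.log =ᵐ[tildeMeasure] id := by
    refine (withDensity_absolutelyContinuous _ _).ae_le ?_
    filter_upwards [ae_restrict_mem measurableSet_Ioi] with x hx using Real.exp_log hx
  rw [Measure.map_congr hae, Measure.map_id]

/-- The coordinate on the line in which `dt / (t ℓ(t))` is Lebesgue measure. -/
noncomputable def logCoord (x : ℝ) : ℝ := SignType.sign x * Real.log (1 + |x|)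

/-- The inverse of `logCoord`. -/
noncomputable def expCoord (y : ℝ) : ℝ := SignType.sign y * (Real.exp |y| - 1)

theorem expCoord_of_nonneg {y : ℝ} (hy : 0 ≤ y) : expCoord y = Real.exp y - 1 := by
  rcases hy.eq_or_lt with rfl | hy
  · simp [expCoord]
  · simp [expCoord, sign_pos hy, abs_of_pos hy]

theorem expCoord_of_nonpos {y : ℝ} (hy : y ≤ 0) : expCoord y = 1 - Real.exp (-y) := by
  rcases hy.eq_or_lt with rfl | hy
  · simp [expCoord]
  · simp [expCoord, sign_neg hy, abs_of_neg hy]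

theorem logCoord_of_nonneg {y : ℝ} (hy : 0 ≤ y) : logCoord y = Real.log (1 + y) := by
  rcases hy.eq_or_lt with rfl | hy
  · simp [logCoord]
  · simp [logCoord, sign_pos hy, abs_of_pos hy]

theorem logCoord_of_nonpos {y : ℝ} (hy : y ≤ 0) : logCoord y = -Real.log (1 - y) := by
  rcases hy.eq_or_lt with rfl | hy
  · simp [logCoord]
  · simp [logCoord, sign_neg hy, abs_of_neg hy, sub_eq_add_neg]

theorem expCoord_neg (y : ℝ) : expCoord (-y) = -expCoord y := by
  simp [expCoord, Left.sign_neg]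

theorem expCoord_logCoord (x : ℝ) : expCoord (logCoord x) = x := by
  rcases le_total 0 x with h | h
  · have : 0 ≤ Real.log (1 + x) := Real.log_nonneg (by linarith)
    rw [logCoord_of_nonneg h, expCoord_of_nonneg this, Real.exp_log (by linarith)]
    ring
  · have : 0 ≤ Real.log (1 - x) := Real.log_nonneg (by linarith)
    rw [logCoord_of_nonpos h, expCoord_of_nonpos (by linarith), neg_neg, Real.exp_log (by linarith)]
    ring

theorem logCoord_expCoord (y : ℝ) : logCoord (expCoord y) = y := by
  rcases le_total 0 y with h | h
  · have : 0 ≤ Real.exp y - 1 := by linarith [Real.add_one_le_exp y]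
    rw [expCoord_of_nonneg h, logCoord_of_nonneg this, add_sub_cancel, Real.log_exp]
  · have : 1 - Real.exp (-y) ≤ 0 := by linarith [Real.add_one_le_exp (-y)]
    rw [expCoord_of_nonpos h, logCoord_of_nonpos this, sub_sub_cancel, Real.log_exp, neg_neg]

theorem expCoord_strictMono : StrictMono expCoord := by
  intro x y hxy
  rcases le_total 0 x with hx | hx
  · rw [expCoord_of_nonneg hx, expCoord_of_nonneg (hx.trans hxy.le)]
    linarith [Real.exp_lt_exp.2 hxy]
  · rw [expCoord_of_nonpos hx]
    rcases le_total 0 y with hy | hy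
    · rw [expCoord_of_nonneg hy]
      have h1 := Real.add_one_le_exp y
      have h2 := Real.add_one_le_exp (-x)
      linarith
    · rw [expCoord_of_nonpos hy]
      linarith [Real.exp_lt_exp.2 (neg_lt_neg hxy)]

theorem hasDerivAt_logCoord (x : ℝ) : HasDerivAt logCoord (1 / (1 + |x|)) x := by
  have hp : 0 ≤ x → HasDerivAt (fun x => Real.log (1 + x)) (1 / (1 + |x|)) x := fun h => by
    rw [abs_of_nonneg h]
    exact ((hasDerivAt_id x).const_add 1).log (by simp; linarith)
  have hn : x ≤ 0 → HasDerivAt (fun x => -Real.log (1 - x)) (1 / (1 + |x|)) x := fun h => by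
    rw [abs_of_nonpos h]
    refine (((hasDerivAt_id x).const_sub 1).log (ne_of_gt (by simp; linarith))).neg.congr_deriv ?_
    rw [neg_div, neg_neg, id, sub_eq_add_neg]
  rcases lt_trichotomy x 0 with h | rfl | h
  · exact (hn h.le).congr_of_eventuallyEq <| by
      filter_upwards [gt_mem_nhds h] with y hy using logCoord_of_nonpos (le_of_lt hy)
  · rw [← hasDerivWithinAt_univ, ← Iic_union_Ici (a := (0 : ℝ))]
    exact ((hn le_rfl).hasDerivWithinAt.congr (fun y hy => logCoord_of_nonpos hy)
      (logCoord_of_nonpos le_rfl)).union ((hp le_rfl).hasDerivWithinAt.congr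
      (fun y hy => logCoord_of_nonneg hy) (logCoord_of_nonneg le_rfl))
  · exact (hp h.le).congr_of_eventuallyEq <| by
      filter_upwards [lt_mem_nhds h] with y hy using logCoord_of_nonneg (le_of_lt hy)

/-- The parametrization of `(0,∞)` by the line that carries Lebesgue measure to
`dt / (t ℓ(t))`. -/
noncomputable def hatParam (y : ℝ) : ℝ := Real.exp (expCoord y)

theorem hatParam_strictMono : StrictMono hatParam :=
  Real.exp_strictMono.comp expCoord_strictMono

theorem hatParam_pos (y : ℝ) : 0 < hatParam y := Real.exp_pos _

theorem hatParam_neg (y : ℝ) : hatParam (-y) = (hatParam y)⁻¹ := by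
  rw [hatParam, expCoord_neg, Real.exp_neg, hatParam]

theorem hatMeasure_eq : hatMeasure = Measure.map hatParam volume := by
  have hmeas : Measurable logCoord :=
    (continuous_iff_continuousAt.2 fun x => (hasDerivAt_logCoord x).continuousAt).measurable
  have h := map_withDensity_deriv (s := Ioi 0) measurableSet_Ioi.nullMeasurableSet
    (g := fun t => logCoord (Real.log t)) (g' := fun t => 1 / (t * ell t))
    (fun x hx => by
      refine ((hasDerivAt_logCoord (Real.log x)).comp x
        (Real.hasDerivAt_log (ne_of_gt hx))).congr_deriv ?_
      simp only [ell, one_div, mul_inv, mul_comm])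
    (fun x hx => one_div_pos.2 (mul_pos hx (by unfold ell; positivity)))
    (fun x hx y hy hxy => Real.log_injOn_pos hx hy <| by
      simpa only [expCoord_logCoord] using congrArg expCoord hxy)
  have himage : (fun t => logCoord (Real.log t)) '' Ioi 0 = univ :=
    eq_univ_of_forall fun y => ⟨hatParam y, hatParam_pos y, by
      simp [hatParam, logCoord_expCoord]⟩
  rw [himage, Measure.restrict_univ] at h
  have h' : Measure.map (fun t => logCoord (Real.log t)) hatMeasure = volume := h
  rw [← h', Measure.map_map (f := fun t => logCoord (Real.log t))
    hatParam_strictMono.monotone.measurable (hmeas.comp Real.measurable_log)]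
  have hae : hatParam ∘ (fun t => logCoord (Real.log t)) =ᵐ[hatMeasure] id := by
    refine (withDensity_absolutelyContinuous _ _).ae_le ?_
    filter_upwards [ae_restrict_mem measurableSet_Ioi] with x hx
    simp [hatParam, expCoord_logCoord, Real.exp_log hx]
  rw [Measure.map_congr hae, Measure.map_id]

theorem measurePreserving_exp : MeasurePreserving Real.exp volume tildeMeasure :=
  ⟨Real.measurable_exp, tildeMeasure_eq.symm⟩

theorem measurePreserving_hatParam : MeasurePreserving hatParam volume hatMeasure :=
  ⟨hatParam_strictMono.monotone.measurable, hatMeasure_eq.symm⟩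

theorem lebesgueImage_volume : LebesgueImage volume := ⟨_, measurePreserving_interleave⟩

theorem lebesgueImage_tildeMeasure : LebesgueImage tildeMeasure :=
  ⟨_, measurePreserving_exp.comp measurePreserving_interleave⟩

theorem measurePreserving_inv_tildeMeasure :
    MeasurePreserving (fun t : ℝ => t⁻¹) tildeMeasure tildeMeasure := by
  refine ⟨measurable_inv, ?_⟩
  rw [tildeMeasure_eq, Measure.map_map measurable_inv Real.measurable_exp]
  have : ((fun t : ℝ => t⁻¹) ∘ Real.exp) = Real.exp ∘ Neg.neg := by
    ext x; simp [Real.exp_neg]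
  rw [this, ← Measure.map_map Real.measurable_exp measurable_neg,
    (Measure.measurePreserving_neg volume).map_eq]

theorem measurePreserving_inv_hatMeasure :
    MeasurePreserving (fun t : ℝ => t⁻¹) hatMeasure hatMeasure := by
  have hm := measurePreserving_hatParam.measurable
  refine ⟨measurable_inv, ?_⟩
  rw [hatMeasure_eq, Measure.map_map measurable_inv hm]
  have : ((fun t : ℝ => t⁻¹) ∘ hatParam) = hatParam ∘ Neg.neg := by
    ext x; simp [hatParam_neg]
  rw [this, ← Measure.map_map hm measurable_neg,
    (Measure.measurePreserving_neg volume).map_eq]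

theorem tildeMeasure_absolutelyContinuous : tildeMeasure ≪ lebMeasure :=
  withDensity_absolutelyContinuous _ _

theorem hatMeasure_absolutelyContinuous : hatMeasure ≪ lebMeasure :=
  withDensity_absolutelyContinuous _ _

theorem ae_pos_hatMeasure : ∀ᵐ u ∂hatMeasure, 0 < u :=
  hatMeasure_absolutelyContinuous.ae_le (ae_restrict_mem measurableSet_Ioi)

theorem ae_pos_tildeMeasure : ∀ᵐ u ∂tildeMeasure, 0 < u :=
  tildeMeasure_absolutelyContinuous.ae_le (ae_restrict_mem measurableSet_Ioi)

/-- Doubling the distribution function at most doubles the norm. -/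
theorem RISpace.normOver_le_two_mul (E : RISpace) {μ ν : Measure ℝ} {f g : ℝ → ℝ≥0∞}
    (h : ∀ s, μ {x | s < f x} ≤ 2 * ν {x | s < g x}) :
    E.normOver μ f ≤ 2 * E.normOver ν g := by
  have hr := (rearrangement_antitone ν g).measurable
  -- A copy of g* on (0,∞) and its mirror image on (-∞,0) have disjoint supports. Their sum thus has
  -- twice the distribution function of g, and the triangle inequality gives the factor 2.
  have hpos : ∀ s, volume {x : ℝ | s < (Ioi 0).indicator (rearrangement ν g) x} =
      ν {x | s < g x} := by
    intro s
    rw [← volume_setOf_ofReal_lt (ν {x | s < g x})]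
    congr 1
    ext x
    by_cases hx : 0 < x <;> simp [hx, lt_rearrangement_iff]
  have hneg : ∀ s, volume {x : ℝ | s < (Ioi 0).indicator (rearrangement ν g) (-x)} =
      ν {x | s < g x} := fun s => by
    rw [← hpos s]
    exact (Measure.measurePreserving_neg volume).measure_preimage
      (measurableSet_lt measurable_const
        (hr.indicator measurableSet_Ioi)).nullMeasurableSet
  have hm := (hr.indicator (measurableSet_Ioi (a := (0 : ℝ))))
  calc E.normOver μ f ≤ E.normOver volume (fun x =>
        (Ioi 0).indicator (rearrangement ν g) x + (Ioi 0).indicator (rearrangement ν g) (-x)) := by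
        refine E.normOver_le_of_dist fun s => (h s).trans ?_
        have hdisj : Disjoint {x : ℝ | s < (Ioi 0).indicator (rearrangement ν g) x}
            {x : ℝ | s < (Ioi 0).indicator (rearrangement ν g) (-x)} := by
          rw [Set.disjoint_left]
          intro x hx hx'
          by_cases h0 : 0 < x
          · have : ¬ 0 < -x := by linarith
            simp [this] at hx'
          · simp [h0] at hx
        rw [two_mul]
        nth_rw 1 [← hpos s]
        rw [← hneg s, ← measure_union hdisj (measurableSet_lt measurable_const
          (hm.comp measurable_neg))]
        refine measure_mono ?_
        rintro x (hx | hx) <;> rw [mem_ofPred_eq] at hx ⊢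
        · exact hx.trans_le le_self_add
        · exact hx.trans_le le_add_self
    _ ≤ _ := E.normOver_add_le lebesgueImage_volume hm.aemeasurable
        (hm.comp measurable_neg).aemeasurable
    _ = 2 * E.normOver ν g := by
        rw [E.normOver_congr_dist hpos, E.normOver_congr_dist hneg, two_mul]

/-! ### Power bounds from the extension indices -/

theorem eventually_dilation_le_of_upperIndex_lt {I : Set ℝ} {φ : ℝ → ℝ≥0∞} {c : ℝ}
    (h : upperIndex I φ < c) :
    ∀ᶠ t in atTop, dilation I φ t ≤ ENNReal.ofReal (t ^ c) := by
  filter_upwards [eventually_lt_of_limsup_lt h, eventually_gt_atTop 1] with t ht ht1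
  have hlog : 0 < Real.log t := Real.log_pos ht1
  by_contra! hlt
  refine absurd ht (not_lt.2 ?_)
  rw [EReal.le_div_iff_mul_le (by exact_mod_cast hlog) (EReal.coe_ne_top _)]
  have hle := ENNReal.log_monotone hlt.le
  rwa [ENNReal.log_ofReal_of_pos (by positivity), Real.log_rpow (by linarith),
    EReal.coe_mul] at hle

theorem eventually_dilation_le_of_lt_lowerIndex {I : Set ℝ} {φ : ℝ → ℝ≥0∞} {c : ℝ}
    (h : c < lowerIndex I φ) :
    ∀ᶠ t in 𝓝[>] 0, dilation I φ t ≤ ENNReal.ofReal (t ^ c) := by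
  filter_upwards [eventually_lt_of_lt_liminf h, Ioo_mem_nhdsGT one_pos] with t ht ht1
  have hlog : Real.log t < 0 := Real.log_neg ht1.1 ht1.2
  by_contra! hlt
  refine absurd ht (not_lt.2 ?_)
  have hle := ENNReal.log_monotone hlt.le
  rw [ENNReal.log_ofReal_of_pos (Real.rpow_pos_of_pos ht1.1 _), Real.log_rpow ht1.1] at hle
  -- Here log t < 0, so dividing by it reverses the inequality; this is why a lower bound on the
  -- index bounds the dilation function from above.
  refine (EReal.div_le_div_right_of_nonpos (by exact_mod_cast hlog.le) hle).trans ?_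
  rw [← EReal.coe_div, mul_div_cancel_right₀ _ hlog.ne]

theorem le_mul_of_dilation_le {I : Set ℝ} {φ : ℝ → ℝ≥0∞} {t s : ℝ} {M : ℝ≥0∞}
    (h : dilation I φ t ≤ M) (hs : s ∈ I) (hts : t * s ∈ I) (h0 : φ s ≠ 0) (hi : φ s ≠ ∞) :
    φ (t * s) ≤ M * φ s := by
  refine (ENNReal.div_le_iff h0 hi).1 (le_trans ?_ h)
  exact le_iSup₂ (f := fun s (_ : s ∈ {s : ℝ | s ∈ I ∧ t * s ∈ I}) => φ (t * s) / φ s) s ⟨hs, hts⟩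

/-- Positive functions on `(0,∞)` with comparable values on each compact set. -/
structure LocallyComparable (b : ℝ → ℝ) : Prop where
  pos : ∀ t > 0, 0 < b t
  le_mul : ∀ p q : ℝ, 0 < p → ∃ K : ℝ, 0 < K ∧ ∀ s ∈ Icc p q, ∀ t ∈ Icc p q, b s ≤ K * b t

/-- Taking ε = 1: almost monotonicity of t b(t) handles s ≤ t, that of b(t)/t handles t ≤ s, and on
[p,q] the powers of t cost at most q/p. -/
theorem SlowlyVarying.locallyComparable {b : ℝ → ℝ} (hb : SlowlyVarying b) :
    LocallyComparable b := by
  refine ⟨hb.pos, fun p q hp => ?_⟩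
  obtain ⟨g, hg, C, hC, hbg⟩ := hb.almostIncreasing 1 one_pos
  obtain ⟨g', hg', C', hC', hbg'⟩ := hb.almostDecreasing 1 one_pos
  simp only [Real.rpow_one, Real.rpow_neg_one] at hbg hbg'
  rcases le_or_gt q 0 with hq | hq
  · exact ⟨1, one_pos, fun s hs => absurd (hs.1.trans hs.2) (by linarith)⟩
  refine ⟨max (C * C * (q / p)) (C' * C' * (q / p)), by positivity, fun s hs t ht => ?_⟩
  have hs0 : 0 < s := hp.trans_le hs.1
  have ht0 : 0 < t := hp.trans_le ht.1
  have hbt := hb.pos t ht0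
  have hbs := hb.pos s hs0
  rcases le_total s t with hst | hst
  · have h1 : s * b s ≤ C * C * (t * b t) := by
      calc s * b s ≤ C * g s := (hbg s hs0).1
        _ ≤ C * g t := by gcongr; exact hg hs0 ht0 hst
        _ ≤ C * (C * (t * b t)) := by gcongr; exact (hbg t ht0).2
        _ = _ := by ring
    have h2 : b s ≤ C * C * (q / p) * b t := by
      calc b s = (s * b s) / s := by field_simp
        _ ≤ (C * C * (t * b t)) / s := by gcongr
        _ ≤ (C * C * (q * b t)) / p := by
            gcongr
            exacts [ht.2, hs.1]
        _ = _ := by ring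
    exact h2.trans (by gcongr; exact le_max_left _ _)
  · have h1 : s⁻¹ * b s ≤ C' * C' * (t⁻¹ * b t) := by
      calc s⁻¹ * b s ≤ C' * g' s := (hbg' s hs0).1
        _ ≤ C' * g' t := by gcongr; exact hg' ht0 hs0 hst
        _ ≤ C' * (C' * (t⁻¹ * b t)) := by gcongr; exact (hbg' t ht0).2
        _ = _ := by ring
    have h2 : b s ≤ C' * C' * (q / p) * b t := by
      calc b s = s * (s⁻¹ * b s) := by field_simp
        _ ≤ s * (C' * C' * (t⁻¹ * b t)) := by gcongr
        _ ≤ q * (C' * C' * (p⁻¹ * b t)) := by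
            gcongr
            exacts [hs.2, ht.1]
        _ = _ := by ring
    exact h2.trans (by gcongr; exact le_max_right _ _)

theorem assocZero_exp (b : ℝ → ℝ) {y : ℝ} (hy : y ≤ 0) :
    assocZero b (Real.exp y) = ENNReal.ofReal (b (hatParam y)) := by
  rw [assocZero, hatParam, expCoord_of_nonpos hy, Real.exp_neg, one_div]

theorem assocInfty_exp (b : ℝ → ℝ) {y : ℝ} (hy : 0 ≤ y) :
    assocInfty b (Real.exp (-y)) = ENNReal.ofReal (b (hatParam y)) := by
  rw [assocInfty, hatParam, expCoord_of_nonneg hy, Real.exp_neg, one_div, inv_inv]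

/-- B_0(e^y) for y < 0 and B_∞(e^{-y}) for y > 0 both equal b at `hatParam y`, so power bounds on
the dilation functions become exponential bounds in y. The two points must lie on the same side of
0, since each associated function sees only one side. -/
theorem exists_pow_decay {b : ℝ → ℝ} (hb : LocallyComparable b)
    (h0 : upperIndex (Ioo 0 1) (assocZero b) < 0)
    (hi : 0 < lowerIndex (Ioo 0 1) (assocInfty b)) :
    ∃ ε > 0, ∃ R > 0, ∀ y' y, y' + R ≤ y → (y < 0 ∨ 0 < y') →
      b (hatParam y) ≤ Real.exp (-ε * (y - y')) * b (hatParam y') := by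
  have hpos : ∀ y, 0 < b (hatParam y) := fun y => hb.pos _ (hatParam_pos y)
  obtain ⟨c₁, h1, h1'⟩ := EReal.lt_iff_exists_real_btwn.1 h0
  obtain ⟨c₂, h2, h2'⟩ := EReal.lt_iff_exists_real_btwn.1 hi
  have hc1 : c₁ < 0 := by exact_mod_cast h1'
  have hc2 : 0 < c₂ := by exact_mod_cast h2
  obtain ⟨R₁, hR₁⟩ := eventually_atTop.1
    (Real.tendsto_exp_atTop.eventually (eventually_dilation_le_of_upperIndex_lt h1))
  have hneg : Tendsto (fun y => Real.exp (-y)) atTop (𝓝[>] 0) :=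
    tendsto_nhdsWithin_iff.2 ⟨Real.tendsto_exp_neg_atTop_nhds_zero,
      Eventually.of_forall fun y => Real.exp_pos _⟩
  obtain ⟨R₂, hR₂⟩ := eventually_atTop.1
    (hneg.eventually (eventually_dilation_le_of_lt_lowerIndex h2'))
  have key : ∀ c d x y : ℝ, 0 ≤ y → c ≤ d → ENNReal.ofReal (b (hatParam x)) ≤
      ENNReal.ofReal (Real.exp c) * ENNReal.ofReal y →
      b (hatParam x) ≤ Real.exp d * y := by
    intro c d x y hy hcd h
    rw [← ENNReal.ofReal_mul (Real.exp_pos _).le,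
      ENNReal.ofReal_le_ofReal_iff (mul_nonneg (Real.exp_pos _).le hy)] at h
    exact h.trans (by gcongr)
  refine ⟨min (-c₁) c₂, lt_min (by linarith) hc2, max 1 (max R₁ R₂), by positivity,
    fun y' y hR hy => ?_⟩
  have hd1 : 1 ≤ y - y' := by linarith [le_max_left 1 (max R₁ R₂)]
  have hd2 : R₁ ≤ y - y' := by linarith [le_max_left R₁ R₂, le_max_right 1 (max R₁ R₂)]
  have hd3 : R₂ ≤ y - y' := by linarith [le_max_right R₁ R₂, le_max_right 1 (max R₁ R₂)]
  rcases hy with hy | hy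
  · have hy' : y' < 0 := by linarith
    have hmul : Real.exp (y - y') * Real.exp y' = Real.exp y := by
      rw [← Real.exp_add, sub_add_cancel]
    have := le_mul_of_dilation_le (hR₁ _ hd2) (s := Real.exp y')
      ⟨Real.exp_pos _, Real.exp_lt_one_iff.2 hy'⟩
      (by rw [hmul]; exact ⟨Real.exp_pos _, Real.exp_lt_one_iff.2 hy⟩)
      (by rw [assocZero_exp b hy'.le]; simpa using hpos y')
      ENNReal.ofReal_ne_top
    rw [hmul, assocZero_exp b hy.le, assocZero_exp b hy'.le, ← Real.exp_mul] at this
    refine key _ _ _ _ (hpos y').le ?_ this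
    nlinarith [min_le_left (-c₁) c₂]
  · have hy' : 0 < y := by linarith
    have hmul : Real.exp (-(y - y')) * Real.exp (-y') = Real.exp (-y) := by
      rw [← Real.exp_add]; congr 1; ring
    have := le_mul_of_dilation_le (hR₂ _ hd3) (s := Real.exp (-y'))
      ⟨Real.exp_pos _, Real.exp_lt_one_iff.2 (by linarith)⟩
      (by rw [hmul]; exact ⟨Real.exp_pos _, Real.exp_lt_one_iff.2 (by linarith)⟩)
      (by rw [assocInfty_exp b hy.le]; simpa using hpos y')
      ENNReal.ofReal_ne_top
    rw [hmul, assocInfty_exp b hy'.le, assocInfty_exp b hy.le, ← Real.exp_mul] at this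
    refine key _ _ _ _ (hpos y').le ?_ this
    nlinarith [min_le_right (-c₁) c₂]

theorem exists_shift_le {b : ℝ → ℝ} (hb : LocallyComparable b)
    (h0 : upperIndex (Ioo 0 1) (assocZero b) < 0)
    (hi : 0 < lowerIndex (Ioo 0 1) (assocInfty b)) {δ : ℝ} (hδ : 0 < δ) :
    ∃ κ > 0, ∀ y, b (hatParam y) ≤ δ * b (hatParam (y - κ)) := by
  have hpos : ∀ y, 0 < b (hatParam y) := fun y => hb.pos _ (hatParam_pos y)
  obtain ⟨ε, hε, R, hR, hdec⟩ := exists_pow_decay hb h0 hi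
  obtain ⟨K, hK, hcomp⟩ := hb.le_mul (hatParam (-(R + 1))) (hatParam (R + 1)) (hatParam_pos _)
  have hloc : ∀ y y', |y| ≤ R + 1 → |y'| ≤ R + 1 → b (hatParam y) ≤ K * b (hatParam y') := by
    have hmem : ∀ y, |y| ≤ R + 1 →
        hatParam y ∈ Icc (hatParam (-(R + 1))) (hatParam (R + 1)) := fun y hy =>
      ⟨hatParam_strictMono.monotone (abs_le.1 hy).1, hatParam_strictMono.monotone (abs_le.1 hy).2⟩
    exact fun y y' hy hy' => hcomp _ (hmem y hy) _ (hmem y' hy')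
  -- K compares values on |y| ≤ R + 1, and the exponential makes the decay bound trivial there.
  -- Beyond this range the decay is started at ±1, because 0 corresponds to the excluded endpoint 1
  -- of (0,1).
  set C := K * Real.exp (ε * (R + 1)) with hC
  have hright : ∀ y, 0 ≤ y → b (hatParam y) ≤ C * Real.exp (-ε * y) * b (hatParam 0) := by
    intro y hy
    rw [hC, mul_assoc K, ← Real.exp_add]
    rcases le_or_gt y (R + 1) with h | h
    · refine (hloc y 0 (by rwa [abs_of_nonneg hy]) (by simp; linarith)).trans ?_
      have : 1 ≤ Real.exp (ε * (R + 1) + -ε * y) := Real.one_le_exp (by nlinarith)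
      have h3 := hpos 0
      gcongr
      nlinarith
    · calc b (hatParam y) ≤ Real.exp (-ε * (y - 1)) * b (hatParam 1) :=
            hdec 1 y (by linarith) (Or.inr one_pos)
        _ ≤ Real.exp (-ε * (y - 1)) * (K * b (hatParam 0)) := by
            gcongr
            exact hloc 1 0 (by simp; linarith) (by simp; linarith)
        _ = K * Real.exp (-ε * (y - 1)) * b (hatParam 0) := by ring
        _ ≤ _ := by
            have h3 := hpos 0
            gcongr
            nlinarith
  have hleft : ∀ y, y ≤ 0 → b (hatParam 0) ≤ C * Real.exp (ε * y) * b (hatParam y) := by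
    intro y hy
    rw [hC, mul_assoc K, ← Real.exp_add]
    have h3 := hpos y
    rcases le_or_gt (-(R + 1)) y with h | h
    · refine (hloc 0 y (by simp; linarith) (by rw [abs_of_nonpos hy]; linarith)).trans ?_
      have : 1 ≤ Real.exp (ε * (R + 1) + ε * y) := Real.one_le_exp (by nlinarith)
      gcongr
      nlinarith
    · calc b (hatParam 0) ≤ K * b (hatParam (-1)) :=
            hloc 0 (-1) (by simp; linarith) (by simp; linarith)
        _ ≤ K * (Real.exp (-ε * (-1 - y)) * b (hatParam y)) := by
            gcongr
            exact hdec y (-1) (by linarith) (Or.inl (by norm_num))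
        _ = K * Real.exp (-ε * (-1 - y)) * b (hatParam y) := by ring
        _ ≤ _ := by
            gcongr
            nlinarith
  -- The constant is 1 when y and y - κ lie on the same side of 0, and C² when the comparison goes
  -- through 0.
  have hlim : Tendsto (fun κ : ℝ => max 1 (C * C) * Real.exp (-ε * κ)) atTop (𝓝 0) := by
    have h1 : Tendsto (fun κ : ℝ => -ε * κ) atTop atBot :=
      tendsto_id.const_mul_atTop_of_neg (by linarith)
    simpa using (Real.tendsto_exp_atBot.comp h1).const_mul (max 1 (C * C))
  obtain ⟨κ, hκδ, hκR⟩ := ((hlim.eventually_lt_const hδ).and (eventually_ge_atTop R)).exists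
  refine ⟨κ, by linarith, fun y => ?_⟩
  have h3 := hpos (y - κ)
  have hmax : ∀ c ≤ max 1 (C * C), c * Real.exp (-ε * κ) * b (hatParam (y - κ)) ≤
      δ * b (hatParam (y - κ)) := fun c hc => by
    gcongr
    exact (mul_le_mul_of_nonneg_right hc (Real.exp_pos _).le).trans hκδ.le
  by_cases hy : y < 0 ∨ 0 < y - κ
  · refine (hdec (y - κ) y (by linarith) hy).trans ?_
    simpa using hmax 1 (le_max_left _ _)
  · push Not at hy
    refine le_trans ?_ (hmax _ (le_max_right _ _))
    have hCpos : 0 < C := by positivity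
    calc b (hatParam y) ≤ C * Real.exp (-ε * y) * b (hatParam 0) := hright y hy.1
      _ ≤ C * Real.exp (-ε * y) * (C * Real.exp (ε * (y - κ)) * b (hatParam (y - κ))) := by
          gcongr
          exact hleft _ hy.2
      _ = C * C * (Real.exp (-ε * y) * Real.exp (ε * (y - κ))) * b (hatParam (y - κ)) := by ring
      _ = _ := by rw [← Real.exp_add]; congr 3; ring

/-! ### The weight `‖a‖` over a half-line -/

theorem RISpace.tildeNorm_eq (F : RISpace) {I : Set ℝ} (hI : MeasurableSet I) {f : ℝ → ℝ≥0∞}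
    (hf : AEMeasurable f tildeMeasure) :
    F.tildeNorm I f = F.normOver volume fun x => I.indicator f (Real.exp x) :=
  (F.normOver_comp measurePreserving_exp (hf.indicator hI)).symm

/-- The norm `‖a‖` over the interval `(0, eᶻ)` with respect to `dt / t`. -/
noncomputable def tailNorm (F : RISpace) (a : ℝ → ℝ) (z : ℝ) : ℝ≥0∞ :=
  F.tildeNorm (Ioo 0 (Real.exp z)) fun t => ENNReal.ofReal (a t)

section Weight

variable (F : RISpace) {a : ℝ → ℝ}

theorem tailNorm_eq (ha : AEMeasurable a tildeMeasure) (z : ℝ) :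
    tailNorm F a z =
      F.normOver volume ((Iio z).indicator fun x => ENNReal.ofReal (a (Real.exp x))) := by
  rw [tailNorm, F.tildeNorm_eq measurableSet_Ioo ha.ennreal_ofReal]
  congr 1
  ext x
  by_cases hx : x < z <;> simp [hx, Real.exp_pos]

theorem aemeasurable_comp_exp (ha : AEMeasurable a tildeMeasure) :
    AEMeasurable (fun x => ENNReal.ofReal (a (Real.exp x))) volume :=
  (ha.comp_quasiMeasurePreserving measurePreserving_exp.quasiMeasurePreserving).ennreal_ofReal

theorem tailNorm_mono (ha : AEMeasurable a tildeMeasure) : Monotone (tailNorm F a) := by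
  intro z z' h
  rw [tailNorm_eq F ha, tailNorm_eq F ha]
  exact F.normOver_mono _ fun x => indicator_le_indicator_of_subset (Iio_subset_Iio h)
    (fun _ => zero_le) x

theorem tailNorm_ne_zero (ha : AEMeasurable a tildeMeasure) (hpos : ∀ t > 0, 0 < a t) (z : ℝ) :
    tailNorm F a z ≠ 0 := by
  rw [tailNorm_eq F ha]
  refine F.normOver_ne_zero lebesgueImage_volume
    ((aemeasurable_comp_exp ha).indicator measurableSet_Iio) fun h => ?_
  have h0 : volume (Iio z) = 0 := measure_mono_null (fun x hx => by
    simpa [mem_Iio.1 hx] using hpos _ (Real.exp_pos x)) (ae_iff.1 h)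
  simp at h0

theorem volume_setOf_comp_two_mul (f : ℝ → ℝ≥0∞) (s : ℝ≥0∞) :
    2 * volume {x | s < f (2 * x)} = volume {x | s < f x} := by
  have h := Real.volume_preimage_mul_left (two_ne_zero (α := ℝ)) {x | s < f x}
  have h' : volume {x | s < f (2 * x)} = 2⁻¹ * volume {x | s < f x} := by
    rw [show (2⁻¹ : ℝ≥0∞) = ENNReal.ofReal |(2 : ℝ)⁻¹| by
      rw [abs_of_pos (by norm_num), ENNReal.ofReal_inv_of_pos two_pos]; simp, ← h]
    rfl
  rw [h', ← mul_assoc, ENNReal.mul_inv_cancel two_ne_zero (by simp), one_mul]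

/-- In the variable x = log t, squaring is x ↦ 2x. Up to the constant for a, the functions on (-∞,z)
and (-∞,2z) are dilates of each other, and a dilation by 2 changes distribution functions by a
factor 2. -/
theorem exists_tailNorm_two_mul (ha : AEMeasurable a tildeMeasure)
    (ha2 : Equivalent (fun t => a (t ^ 2)) a) :
    ∃ C : ℝ≥0, 1 ≤ C ∧ ∀ z, tailNorm F a z ≤ C * tailNorm F a (2 * z) ∧
      tailNorm F a (2 * z) ≤ C * tailNorm F a z := by
  obtain ⟨C, hC, hC2⟩ := ha2
  set α : ℝ → ℝ≥0∞ := fun x => ENNReal.ofReal (a (Real.exp x)) with hα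
  have hαm := aemeasurable_comp_exp ha
  have hsq : ∀ x : ℝ, Real.exp x ^ 2 = Real.exp (2 * x) := fun x => by
    rw [← Real.exp_nat_mul]; norm_num
  have h1 : ∀ x, α x ≤ ENNReal.ofReal C * α (2 * x) := fun x => by
    rw [hα, ← ENNReal.ofReal_mul hC.le, ← hsq]
    exact ENNReal.ofReal_le_ofReal (hC2 _ (Real.exp_pos x)).2
  have h2 : ∀ x, α (2 * x) ≤ ENNReal.ofReal C * α x := fun x => by
    simp only [hα]
    rw [← ENNReal.ofReal_mul hC.le, ← hsq]
    exact ENNReal.ofReal_le_ofReal (hC2 _ (Real.exp_pos x)).1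
  have hind : ∀ x z : ℝ, ((Iio (2 * z)).indicator α (2 * x)) = (Iio z).indicator
      (fun x => α (2 * x)) x := fun x z => by
    by_cases hx : x < z <;> simp [hx]
  refine ⟨max 1 (2 * C.toNNReal), le_max_left _ _, fun z => ?_⟩
  rw [tailNorm_eq F ha, tailNorm_eq F ha]
  have hcoe : (2 : ℝ≥0∞) * ENNReal.ofReal C ≤ ((max 1 (2 * C.toNNReal) : ℝ≥0) : ℝ≥0∞) := by
    have : ((2 * C.toNNReal : ℝ≥0) : ℝ≥0∞) = 2 * ENNReal.ofReal C := by
      rw [ENNReal.coe_mul]; rfl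
    rw [← this]
    exact_mod_cast le_max_right _ _
  have hm := fun z : ℝ => hαm.indicator (measurableSet_Iio (a := z))
  constructor
  · calc F.normOver volume ((Iio z).indicator α)
        ≤ F.normOver volume (fun x => ENNReal.ofReal C * (Iio (2 * z)).indicator α x) := by
          refine F.normOver_le_of_dist fun s => ?_
          rw [← volume_setOf_comp_two_mul
            (fun x => ENNReal.ofReal C * (Iio (2 * z)).indicator α x)]
          refine le_trans (measure_mono fun x hx => ?_)
            (le_mul_of_one_le_left zero_le one_le_two)
          refine lt_of_lt_of_le (mem_ofPred_eq ▸ hx) ?_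
          rw [hind]
          by_cases hx : x < z <;> simp [hx, h1]
      _ = ENNReal.ofReal C * F.normOver volume ((Iio (2 * z)).indicator α) :=
          F.normOver_const_mul lebesgueImage_volume _ (hm _)
      _ ≤ _ := by
          gcongr
          exact (le_mul_of_one_le_left zero_le one_le_two).trans hcoe
  · calc F.normOver volume ((Iio (2 * z)).indicator α)
        ≤ 2 * F.normOver volume (fun x => ENNReal.ofReal C * (Iio z).indicator α x) := by
          refine F.normOver_le_two_mul fun s => ?_
          rw [← volume_setOf_comp_two_mul]
          gcongr with x
          rw [hind]
          by_cases hx : x < z <;> simp [hx, h2]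
      _ = 2 * ENNReal.ofReal C * F.normOver volume ((Iio z).indicator α) := by
          rw [F.normOver_const_mul lebesgueImage_volume _ (hm _), mul_assoc]
      _ ≤ _ := by gcongr

theorem exists_tailNorm_shift_le (ha : AEMeasurable a tildeMeasure) (hpos : ∀ t > 0, 0 < a t)
    (ha2 : Equivalent (fun t => a (t ^ 2)) a) (hfin : ∀ z, tailNorm F a z ≠ ∞) {κ : ℝ}
    (hκ : 0 < κ) :
    ∃ C : ℝ≥0, ∀ y, tailNorm F a (expCoord y) ≤ C * tailNorm F a (expCoord (y - κ)) := by
  obtain ⟨C, hC1, hC⟩ := exists_tailNorm_two_mul F ha ha2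
  have hmono := tailNorm_mono F ha
  have hdown : ∀ (n : ℕ) z, tailNorm F a z ≤ (C : ℝ≥0∞) ^ n * tailNorm F a (2 ^ n * z) := by
    intro n
    induction n with
    | zero => simp
    | succ n ih =>
      intro z
      refine (ih z).trans ?_
      rw [pow_succ, mul_assoc, pow_succ', mul_assoc 2]
      gcongr
      exact (hC _).1
  have hup : ∀ (n : ℕ) z, tailNorm F a (2 ^ n * z) ≤ (C : ℝ≥0∞) ^ n * tailNorm F a z := by
    intro n
    induction n with
    | zero => simp
    | succ n ih =>
      intro z
      rw [pow_succ' 2, mul_assoc 2, pow_succ', mul_assoc]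
      refine (hC _).2.trans ?_
      gcongr
      exact ih z
  -- Away from 0, `expCoord` is nearly ±e^{|y|}, so translation by κ multiplies it by about e^κ. The
  -- extra factor 2 absorbs the summand 1 once the exponential is at least 2; n doublings then
  -- suffice.
  obtain ⟨n, hn⟩ := pow_unbounded_of_one_lt (2 * Real.exp κ) one_lt_two
  -- This ratio serves the middle range -1 < y < κ + 1, by monotonicity and finiteness of the norm.
  set K : ℝ≥0 := (tailNorm F a (expCoord (κ + 1)) / tailNorm F a (expCoord (-1 - κ))).toNNReal
    with hK
  have hKle : tailNorm F a (expCoord (κ + 1)) ≤ K * tailNorm F a (expCoord (-1 - κ)) := by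
    have h0 := tailNorm_ne_zero F ha hpos (expCoord (-1 - κ))
    rw [hK, ENNReal.coe_toNNReal (ENNReal.div_ne_top (hfin _) h0),
      ENNReal.div_mul_cancel h0 (hfin _)]
  have he : (2 : ℝ) ≤ Real.exp 1 := by linarith [Real.add_one_le_exp (1 : ℝ)]
  refine ⟨max (C ^ n) K, fun y => ?_⟩
  rw [ENNReal.coe_max, ENNReal.coe_pow]
  rcases le_or_gt y (-1) with hy | hy
  · refine (hdown n _).trans (mul_le_mul' (le_max_left _ _) (hmono ?_))
    rw [expCoord_of_nonpos (by linarith), expCoord_of_nonpos (by linarith),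
      show -(y - κ) = κ + -y by ring, Real.exp_add]
    have h1 : 2 ≤ Real.exp (-y) := he.trans (Real.exp_le_exp.2 (by linarith))
    have h2 := Real.exp_pos κ
    nlinarith
  rcases le_or_gt (κ + 1) y with hy' | hy'
  · refine (hmono ?_).trans ((hup n _).trans (mul_le_mul' (le_max_left _ _) le_rfl))
    rw [expCoord_of_nonneg (by linarith), expCoord_of_nonneg (by linarith)]
    have h1 : 2 ≤ Real.exp (y - κ) := he.trans (Real.exp_le_exp.2 (by linarith))
    have h2 := Real.exp_pos κ
    have h3 : Real.exp y = Real.exp κ * Real.exp (y - κ) := by rw [← Real.exp_add]; congr 1; ring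
    rw [h3]
    nlinarith
  · calc tailNorm F a (expCoord y) ≤ tailNorm F a (expCoord (κ + 1)) :=
          hmono (expCoord_strictMono.monotone hy'.le)
      _ ≤ K * tailNorm F a (expCoord (-1 - κ)) := hKle
      _ ≤ _ := mul_le_mul' (le_max_right _ _)
          (hmono (expCoord_strictMono.monotone (by linarith)))

theorem exists_le_rpow_near_zero (ha : LocallyComparable a) {c : ℝ}
    (h : c < lowerIndex (Ioo 0 1) (assocZero a)) :
    ∃ K > 0, ∃ L₀ : ℝ, 1 ≤ L₀ ∧ ∀ L ≥ L₀, a (Real.exp (1 - L)) ≤ K * L ^ (-c) := by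
  have hd := eventually_dilation_le_of_lt_lowerIndex h
  have hlim : Tendsto (fun L : ℝ => 2 * L⁻¹) atTop (𝓝[>] 0) := by
    refine tendsto_nhdsWithin_iff.2 ⟨by simpa using tendsto_inv_atTop_zero.const_mul (2 : ℝ), ?_⟩
    filter_upwards [eventually_gt_atTop 0] with L hL
    exact mul_pos two_pos (inv_pos.2 hL)
  obtain ⟨L₀, hL₀⟩ := eventually_atTop.1 (hlim.eventually hd)
  have hapos : 0 < a (Real.exp (1 - 1 / 2⁻¹)) := ha.pos _ (Real.exp_pos _)
  refine ⟨2 ^ c * a (Real.exp (1 - 1 / 2⁻¹)), by positivity, max 2 L₀,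
    one_le_two.trans (le_max_left _ _), fun L hL => ?_⟩
  have hL2 : 2 ≤ L := (le_max_left _ _).trans hL
  have hLpos : 0 < L := by linarith
  -- A_0(1/L) = a(e^{1-L}) is compared with A_0(1/2), since the base point must lie inside (0,1).
  have hmul : 2 * L⁻¹ * 2⁻¹ = L⁻¹ := by field_simp
  have := le_mul_of_dilation_le (hL₀ L ((le_max_right _ _).trans hL)) (s := 2⁻¹)
    ⟨by norm_num, by norm_num⟩
    (by rw [hmul]; exact ⟨inv_pos.2 hLpos, inv_lt_one_of_one_lt₀ (by linarith)⟩)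
    (by simpa [assocZero] using hapos) ENNReal.ofReal_ne_top
  rw [hmul, assocZero, assocZero, ← ENNReal.ofReal_mul (by positivity),
    ENNReal.ofReal_le_ofReal_iff (by positivity), one_div, inv_inv,
    Real.mul_rpow two_pos.le (inv_pos.2 hLpos).le, Real.inv_rpow hLpos.le,
    ← Real.rpow_neg hLpos.le] at this
  linarith

theorem fundamental_le_rpow {c : ℝ} (h : upperIndex (Ioi 0) F.fundamental < c) :
    ∃ T : ℝ, ∀ t ≥ T, F.fundamental t ≤ ENNReal.ofReal (t ^ c) * F.fundamental 1 := by
  obtain ⟨T, hT⟩ := eventually_atTop.1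
    ((eventually_dilation_le_of_upperIndex_lt h).and (eventually_gt_atTop 0))
  refine ⟨T, fun t ht => ?_⟩
  simpa using le_mul_of_dilation_le (hT t ht).1 (s := 1) (mem_Ioi.2 one_pos)
    (by simpa using (hT t ht).2) (F.fundamental_ne_zero one_pos) (F.fundamental_lt_top 1).ne

/-- A negative exponent would make the fundamental function drop below its value at 1, although it
is increasing. -/
theorem nonneg_of_upperIndex_fundamental_lt {c : ℝ}
    (h : upperIndex (Ioi 0) F.fundamental < c) : 0 ≤ c := by
  obtain ⟨T, hT⟩ := fundamental_le_rpow F h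
  by_contra! hc
  set t := max T 2 with ht
  have ht2 : 1 < t := one_lt_two.trans_le (le_max_right _ _)
  have hlt : F.fundamental t < F.fundamental 1 := by
    refine (hT t (le_max_left _ _)).trans_lt ?_
    conv_rhs => rw [← one_mul (F.fundamental 1)]
    exact ENNReal.mul_lt_mul_left (F.fundamental_ne_zero one_pos) (F.fundamental_lt_top 1).ne
      (ENNReal.ofReal_lt_one.2 (Real.rpow_lt_one_of_one_lt_of_neg ht2 hc))
  have hm : ∀ r : ℝ, AEMeasurable ((Ioo 0 r).indicator (1 : ℝ → ℝ≥0∞)) lebMeasure := fun r =>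
    (measurable_one.indicator measurableSet_Ioo).aemeasurable
  refine absurd hlt (not_lt.2 ?_)
  rw [RISpace.fundamental, RISpace.fundamental, F.norm_eq_normOver (hm _),
    F.norm_eq_normOver (hm _)]
  exact F.normOver_mono _ fun x => indicator_le_indicator_of_subset
    (Ioo_subset_Ioo_right ht2.le) (fun _ => zero_le) x

/-- With ρ_{φ_F} < c < c' < π_{A_0}, the dyadic block where 1 - x is about 2^m carries values at
most of order 2^{-mc'} on a set of measure 2^m, hence norm at most of order 2^{m(c-c')}. These sum
geometrically; the remaining bounded interval is harmless because a is locally bounded. -/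
theorem tailNorm_ne_top (ha : AEMeasurable a tildeMeasure) (hloc : LocallyComparable a)
    (h : upperIndex (Ioi 0) F.fundamental < lowerIndex (Ioo 0 1) (assocZero a)) (z : ℝ) :
    tailNorm F a z ≠ ∞ := by
  obtain ⟨c', h1, h2⟩ := EReal.lt_iff_exists_real_btwn.1 h
  obtain ⟨c, h3, h4⟩ := EReal.lt_iff_exists_real_btwn.1 h1
  have hcc : c < c' := by exact_mod_cast h4
  obtain ⟨K, hK, L₀, hL₀, haL⟩ := exists_le_rpow_near_zero hloc h2
  obtain ⟨T, hT⟩ := fundamental_le_rpow F h3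
  obtain ⟨N, hN⟩ := pow_unbounded_of_one_lt (max L₀ T) (one_lt_two (α := ℝ))
  have hN1 : L₀ ≤ 2 ^ N := (le_max_left _ _).trans hN.le
  have hN2 : T ≤ 2 ^ N := (le_max_right _ _).trans hN.le
  have hpow : ∀ k : ℕ, (2 : ℝ) ^ N ≤ 2 ^ (N + k) := fun k =>
    pow_le_pow_right₀ one_le_two (Nat.le_add_right _ _)
  set r : ℝ := 2 ^ (c - c') with hr
  have hr0 : 0 < r := by positivity
  have hr1 : r < 1 := Real.rpow_lt_one_of_one_lt_of_neg one_lt_two (by linarith)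
  obtain ⟨M, hM⟩ : ∃ M : ℝ, ∀ x, 1 - 2 ^ N ≤ x → x ≤ z → a (Real.exp x) ≤ M := by
    obtain ⟨K', -, hK'⟩ := hloc.le_mul (Real.exp (1 - 2 ^ N)) (Real.exp z) (Real.exp_pos _)
    rcases le_or_gt (1 - 2 ^ N) z with hz | hz
    · exact ⟨K' * a (Real.exp z), fun x hx hxz => hK' _ ⟨by gcongr, by gcongr⟩ _
        ⟨by gcongr, le_rfl⟩⟩
    · exact ⟨0, fun x hx hxz => by linarith⟩
  set cst : ℕ → ℝ≥0∞ := fun k => ENNReal.ofReal (K * (2 ^ (N + k)) ^ (-c')) with hcst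
  set S : ℕ → Set ℝ := fun k => Ioc (1 - 2 ^ (N + k + 1)) (1 - 2 ^ (N + k)) with hS
  set f : ℕ → ℝ → ℝ≥0∞ := fun k => (S k).indicator fun _ => cst k with hf
  set g : ℝ → ℝ≥0∞ := (Ioo (1 - 2 ^ N) z).indicator fun _ => ENNReal.ofReal M with hg
  have hpt : ∀ x, (Iio z).indicator (fun x => ENNReal.ofReal (a (Real.exp x))) x ≤
      g x + ∑' k, f k x := by
    intro x
    by_cases hxz : x < z
    swap
    · simp [hxz]
    rw [indicator_of_mem (mem_Iio.2 hxz)]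
    rcases lt_or_ge (1 - 2 ^ N) x with hx | hx
    · rw [hg, indicator_of_mem (show x ∈ Ioo (1 - 2 ^ N) z from ⟨hx, hxz⟩)]
      exact (ENNReal.ofReal_le_ofReal (hM x hx.le hxz.le)).trans le_self_add
    -- The block index k is determined by 2^{N+k} ≤ 1 - x < 2^{N+k+1}.
    · have h1 : (1 : ℝ) ≤ (1 - x) / 2 ^ N := by rw [le_div_iff₀ (by positivity)]; linarith
      obtain ⟨k, hk1, hk2⟩ := exists_nat_pow_near h1 one_lt_two
      rw [le_div_iff₀ (by positivity), ← pow_add, add_comm] at hk1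
      rw [div_lt_iff₀ (by positivity), ← pow_add, add_comm, ← add_assoc] at hk2
      have hfk : f k x = cst k := indicator_of_mem
        (show x ∈ Ioc (1 - 2 ^ (N + k + 1)) (1 - 2 ^ (N + k) : ℝ) from ⟨by linarith, by linarith⟩) _
      have hax : ENNReal.ofReal (a (Real.exp x)) ≤ f k x := by
        rw [hfk]
        refine ENNReal.ofReal_le_ofReal ?_
        have := haL (1 - x) (hN1.trans ((hpow k).trans hk1))
        rw [sub_sub_cancel] at this
        refine this.trans ?_
        have hc'0 : -c' ≤ 0 := by linarith [nonneg_of_upperIndex_fundamental_lt F h3]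
        exact mul_le_mul_of_nonneg_left
          (Real.rpow_le_rpow_of_nonpos (by positivity) hk1 hc'0) hK.le
      exact hax.trans ((ENNReal.le_tsum k).trans le_add_self)
  have hfm : ∀ k, AEMeasurable (f k) volume := fun k =>
    aemeasurable_const.indicator measurableSet_Ioc
  have hgm : AEMeasurable g volume := aemeasurable_const.indicator measurableSet_Ioo
  have hfk : ∀ k, F.normOver volume (f k) ≤
      ENNReal.ofReal (K * r ^ N) * F.fundamental 1 * ENNReal.ofReal r ^ k := by
    intro k
    have hvol : volume (S k) ≤ ENNReal.ofReal (2 ^ (N + k)) := by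
      rw [hS, Real.volume_Ioc]
      refine ENNReal.ofReal_le_ofReal ?_
      rw [pow_succ]; linarith
    refine (F.normOver_indicator_le hvol _).trans ?_
    refine (mul_le_mul' le_rfl (hT _ (hN2.trans (hpow k)))).trans (le_of_eq ?_)
    rw [hcst, ← mul_assoc, ← ENNReal.ofReal_mul (by positivity), ← ENNReal.ofReal_pow hr0.le,
      mul_right_comm (ENNReal.ofReal (K * r ^ N)), ← ENNReal.ofReal_mul (by positivity)]
    congr 2
    rw [mul_assoc, mul_assoc, ← Real.rpow_add (by positivity), ← pow_add, hr, ← Real.rpow_natCast,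
      ← Real.rpow_natCast, ← Real.rpow_mul two_pos.le, ← Real.rpow_mul two_pos.le]
    congr 2
    ring
  rw [tailNorm_eq F ha]
  refine ne_top_of_le_ne_top ?_ ((F.normOver_mono _ hpt).trans
    ((F.normOver_add_le lebesgueImage_volume hgm (AEMeasurable.tsum hfm)).trans
      (add_le_add le_rfl ((F.normOver_tsum_le lebesgueImage_volume hfm).trans
        (ENNReal.tsum_le_tsum hfk)))))
  rw [ENNReal.tsum_mul_left, ENNReal.tsum_geometric]
  refine ENNReal.add_ne_top.2 ⟨?_, ?_⟩
  · refine ne_top_of_le_ne_top ?_ (F.normOver_indicator_le (r := z - (1 - 2 ^ N))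
      (by rw [Real.volume_Ioo]) _)
    exact ENNReal.mul_ne_top ENNReal.ofReal_ne_top (F.fundamental_lt_top _).ne
  · refine ENNReal.mul_ne_top (ENNReal.mul_ne_top ENNReal.ofReal_ne_top
      (F.fundamental_lt_top _).ne) (ENNReal.inv_ne_top.2 ?_)
    exact (tsub_pos_of_lt (ENNReal.ofReal_lt_one.2 hr1)).ne'

end Weight

/-! ### The equivalence for the intervals `(0, u)` -/

theorem RISpace.tildeNorm_mono_set (G : RISpace) {I J : Set ℝ} (h : I ⊆ J) (f : ℝ → ℝ≥0∞) :
    G.tildeNorm I f ≤ G.tildeNorm J f :=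
  G.normOver_mono _ fun x => indicator_le_indicator_of_subset h (fun _ => zero_le) x

theorem RISpace.tildeNorm_mono (G : RISpace) {I J : Set ℝ} {f g : ℝ → ℝ≥0∞}
    (h : ∀ t ∈ I, t ∈ J ∧ f t ≤ g t) : G.tildeNorm I f ≤ G.tildeNorm J g :=
  G.normOver_mono _ fun x => by
    by_cases hx : x ∈ I
    · rw [indicator_of_mem hx, indicator_of_mem (h x hx).1]
      exact (h x hx).2
    · simp [hx]

theorem RISpace.tildeNorm_const_mul (G : RISpace) {I : Set ℝ} (hI : MeasurableSet I) (c : ℝ≥0∞)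
    {f : ℝ → ℝ≥0∞} (hf : AEMeasurable f tildeMeasure) :
    G.tildeNorm I (fun t => c * f t) = c * G.tildeNorm I f := by
  rw [tildeNorm, tildeNorm, ← G.normOver_const_mul lebesgueImage_tildeMeasure c (hf.indicator hI)]
  congr 1
  ext t
  by_cases ht : t ∈ I <;> simp [ht]

theorem RISpace.tildeNorm_Ioo_le_add (G : RISpace) (p q r : ℝ) {f : ℝ → ℝ≥0∞}
    (hf : AEMeasurable f tildeMeasure) :
    G.tildeNorm (Ioo p r) f ≤ G.tildeNorm (Ioo p q) f + G.tildeNorm (Ioo q r) f := by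
  refine le_trans (G.normOver_mono_ae ?_) (G.normOver_add_le lebesgueImage_tildeMeasure
    (hf.indicator measurableSet_Ioo) (hf.indicator measurableSet_Ioo))
  have hq : ∀ᵐ x ∂lebMeasure, x ≠ q := ae_restrict_of_ae (Measure.ae_ne volume q)
  filter_upwards [tildeMeasure_absolutelyContinuous.ae_le hq] with x hx
  by_cases hxI : x ∈ Ioo p r
  · rw [indicator_of_mem hxI]
    rcases lt_or_gt_of_ne hx with h | h
    · rw [indicator_of_mem (show x ∈ Ioo p q from ⟨hxI.1, h⟩)]
      exact le_self_add
    · rw [indicator_of_mem (show x ∈ Ioo q r from ⟨h, hxI.2⟩)]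
      exact le_add_self
  · simp [hxI]

/-- The function `b(u) ‖f‖` with the norm of `G` over `(0, u)`. -/
noncomputable def outerProfile (G : RISpace) (b : ℝ → ℝ) (f : ℝ → ℝ≥0∞) (u : ℝ) : ℝ≥0∞ :=
  ENNReal.ofReal (b u) * G.tildeNorm (Ioo 0 u) f

/-- The function `b(u) ‖a‖⁻¹ ‖a(t) ‖f‖‖` with the norms of `F` over `(0, u)` and the norm of `G`
over `(t, u)`. -/
noncomputable def averagedProfile (F G : RISpace) (a b : ℝ → ℝ) (f : ℝ → ℝ≥0∞) (u : ℝ) : ℝ≥0∞ :=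
  ENNReal.ofReal (b u) / F.tildeNorm (Ioo 0 u) (fun t => ENNReal.ofReal (a t)) *
    F.tildeNorm (Ioo 0 u) (fun t => ENNReal.ofReal (a t) * G.tildeNorm (Ioo t u) f)

section Profiles

variable (F G : RISpace) {a b : ℝ → ℝ} (f : ℝ → ℝ≥0∞)

/-- The norm over (0,u) increases with u, so it is measurable in u whatever f is. -/
theorem aemeasurable_outerProfile (hb : AEMeasurable b hatMeasure) :
    AEMeasurable (outerProfile G b f) hatMeasure := by
  have hm : Monotone fun u => G.tildeNorm (Ioo 0 u) f := fun u v h =>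
    G.tildeNorm_mono_set (Ioo_subset_Ioo_right h) f
  exact hb.ennreal_ofReal.mul hm.measurable.aemeasurable

theorem aemeasurable_averagedProfile (hb : AEMeasurable b hatMeasure) :
    AEMeasurable (averagedProfile F G a b f) hatMeasure := by
  have hm : Monotone fun u => F.tildeNorm (Ioo 0 u) (fun t => ENNReal.ofReal (a t)) :=
    fun u v h => F.tildeNorm_mono_set (Ioo_subset_Ioo_right h) _
  have hm' : Monotone fun u => F.tildeNorm (Ioo 0 u)
      (fun t => ENNReal.ofReal (a t) * G.tildeNorm (Ioo t u) f) := fun u v h =>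
    F.tildeNorm_mono fun t ht => ⟨Ioo_subset_Ioo_right h ht,
      mul_le_mul' le_rfl (G.tildeNorm_mono_set (Ioo_subset_Ioo_right h) f)⟩
  exact (hb.ennreal_ofReal.div hm.measurable.aemeasurable).mul hm'.measurable.aemeasurable

theorem averagedProfile_le_outerProfile (ha : AEMeasurable a tildeMeasure) (u : ℝ) :
    averagedProfile F G a b f u ≤ outerProfile G b f u := by
  set N := G.tildeNorm (Ioo 0 u) f with hN
  set W := F.tildeNorm (Ioo 0 u) (fun t => ENNReal.ofReal (a t)) with hW
  calc averagedProfile F G a b f u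
      ≤ ENNReal.ofReal (b u) / W * F.tildeNorm (Ioo 0 u) (fun t => N * ENNReal.ofReal (a t)) := by
        refine mul_le_mul' le_rfl (F.tildeNorm_mono fun t ht => ⟨ht, ?_⟩)
        rw [mul_comm]
        gcongr
        exact G.tildeNorm_mono_set (Ioo_subset_Ioo_left ht.1.le) f
    _ = ENNReal.ofReal (b u) / W * W * N := by
        rw [F.tildeNorm_const_mul measurableSet_Ioo _ ha.ennreal_ofReal, ← hW, mul_comm N,
          mul_assoc]
    -- Only (b/W)·W ≤ b is needed, which holds even when W is 0 or ∞.
    _ ≤ _ := mul_le_mul' (by rw [mul_comm]; exact ENNReal.mul_div_le) le_rfl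

/-- For t < v the interval (t,u) contains (v,u), so restricting the outer norm to (0,v) pulls out
the norm of f over (v,u) times the norm of a over (0,v), which is comparable to that over (0,u). -/
theorem mul_tildeNorm_Ioo_le_averagedProfile (ha : AEMeasurable a tildeMeasure) {C : ℝ≥0}
    {u v : ℝ} (h0 : F.tildeNorm (Ioo 0 u) (fun t => ENNReal.ofReal (a t)) ≠ 0)
    (hi : F.tildeNorm (Ioo 0 u) (fun t => ENNReal.ofReal (a t)) ≠ ∞) (hvu : v ≤ u)
    (hC : F.tildeNorm (Ioo 0 u) (fun t => ENNReal.ofReal (a t)) ≤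
      C * F.tildeNorm (Ioo 0 v) (fun t => ENNReal.ofReal (a t))) :
    ENNReal.ofReal (b u) * G.tildeNorm (Ioo v u) f ≤ C * averagedProfile F G a b f u := by
  set N := G.tildeNorm (Ioo v u) f with hN
  set W := F.tildeNorm (Ioo 0 u) (fun t => ENNReal.ofReal (a t)) with hW
  have hinner : N * F.tildeNorm (Ioo 0 v) (fun t => ENNReal.ofReal (a t)) ≤
      F.tildeNorm (Ioo 0 u) (fun t => ENNReal.ofReal (a t) * G.tildeNorm (Ioo t u) f) := by
    rw [← F.tildeNorm_const_mul measurableSet_Ioo _ ha.ennreal_ofReal]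
    refine F.tildeNorm_mono fun t ht => ⟨Ioo_subset_Ioo_right hvu ht, ?_⟩
    rw [mul_comm]
    gcongr
    exact G.tildeNorm_mono_set (Ioo_subset_Ioo_left ht.2.le) f
  calc ENNReal.ofReal (b u) * N = ENNReal.ofReal (b u) / W * W * N := by
        rw [ENNReal.div_mul_cancel h0 hi]
    _ ≤ ENNReal.ofReal (b u) / W *
        (C * F.tildeNorm (Ioo 0 v) (fun t => ENNReal.ofReal (a t))) * N := by gcongr
    _ = C * (ENNReal.ofReal (b u) / W *
        (N * F.tildeNorm (Ioo 0 v) (fun t => ENNReal.ofReal (a t)))) := by ring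
    _ ≤ _ := by
        unfold averagedProfile
        gcongr

/-- The intervals exhaust (0,u), so this is the Fatou property. It allows finitely many translation
steps to suffice. -/
theorem iSup_tildeNorm_hatParam {f : ℝ → ℝ≥0∞} (hf : AEMeasurable f tildeMeasure) {κ : ℝ}
    (hκ : 0 < κ) (y : ℝ) :
    G.tildeNorm (Ioo 0 (hatParam y)) f =
      ⨆ n : ℕ, G.tildeNorm (Ioo (hatParam (y - n * κ)) (hatParam y)) f := by
  have hsub : ∀ m n : ℕ, m ≤ n → Ioo (hatParam (y - m * κ)) (hatParam y) ⊆
      Ioo (hatParam (y - n * κ)) (hatParam y) := fun m n hmn =>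
    Ioo_subset_Ioo_left (hatParam_strictMono.monotone (by gcongr))
  unfold RISpace.tildeNorm
  rw [← G.normOver_iSup lebesgueImage_tildeMeasure (fun n => hf.indicator measurableSet_Ioo)
    (fun m n hmn x => indicator_le_indicator_of_subset (hsub m n hmn) (fun _ => zero_le) x)]
  congr 1
  ext t
  refine le_antisymm ?_ (iSup_le fun n => indicator_le_indicator_of_subset
    (Ioo_subset_Ioo_left (hatParam_pos _).le) (fun _ => zero_le) t)
  by_cases ht : t ∈ Ioo 0 (hatParam y)
  swap
  · simp [ht]
  obtain ⟨n, hn⟩ := exists_nat_gt ((y - logCoord (Real.log t)) / κ)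
  rw [div_lt_iff₀ hκ] at hn
  have hlt : hatParam (y - n * κ) < t := by
    have : t = hatParam (logCoord (Real.log t)) := by
      rw [hatParam, expCoord_logCoord, Real.exp_log ht.1]
    rw [this]
    exact hatParam_strictMono (by linarith)
  refine le_trans ?_ (le_iSup _ n)
  rw [indicator_of_mem ht, indicator_of_mem (show t ∈ Ioo _ _ from ⟨hlt, ht.2⟩)]

theorem hatNorm_outerProfile_le (E : RISpace) (ha : AEMeasurable a tildeMeasure)
    (hb : AEMeasurable b hatMeasure) (hal : LocallyComparable a) (hbl : LocallyComparable b)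
    (ha2 : Equivalent (fun t => a (t ^ 2)) a)
    (hF : upperIndex (Ioi 0) F.fundamental < lowerIndex (Ioo 0 1) (assocZero a))
    (hb0 : upperIndex (Ioo 0 1) (assocZero b) < 0)
    (hbi : 0 < lowerIndex (Ioo 0 1) (assocInfty b)) :
    ∃ C : ℝ≥0, ∀ f : ℝ → ℝ≥0∞, AEMeasurable f tildeMeasure →
      E.hatNorm (outerProfile G b f) ≤ C * E.hatNorm (averagedProfile F G a b f) := by
  obtain ⟨κ, hκ, hshift⟩ := exists_shift_le hbl hb0 hbi (δ := 2⁻¹) (by norm_num)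
  have hfin := tailNorm_ne_top F ha hal hF
  obtain ⟨C, hC⟩ := exists_tailNorm_shift_le F ha hal.pos ha2 hfin hκ
  refine ⟨2 * C, fun f hf => ?_⟩
  set h : ℝ → ℝ≥0∞ := fun y => C * averagedProfile F G a b f (hatParam y) with hh
  set N : ℝ → ℝ → ℝ≥0∞ := fun y' y => G.tildeNorm (Ioo (hatParam y') (hatParam y)) f with hN
  have hprof := (aemeasurable_averagedProfile F G (a := a) f hb).comp_quasiMeasurePreserving
    measurePreserving_hatParam.quasiMeasurePreserving
  have hhm : AEMeasurable h volume := hprof.const_mul _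
  have hstep : ∀ y, ENNReal.ofReal (b (hatParam y)) * N (y - κ) y ≤ h y := fun y =>
    mul_tildeNorm_Ioo_le_averagedProfile F G f ha (tailNorm_ne_zero F ha hal.pos (expCoord y))
      (hfin _) (hatParam_strictMono.monotone (by linarith)) (hC y)
  have hbshift : ∀ y, ENNReal.ofReal (b (hatParam y)) ≤
      2⁻¹ * ENNReal.ofReal (b (hatParam (y - κ))) := fun y => by
    rw [show (2⁻¹ : ℝ≥0∞) = ENNReal.ofReal 2⁻¹ by
      rw [ENNReal.ofReal_inv_of_pos two_pos]; simp, ← ENNReal.ofReal_mul (by norm_num)]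
    exact ENNReal.ofReal_le_ofReal (hshift y)
  -- Induction on the number of pieces: the piece nearest to u is bounded by h(y), and on the rest
  -- the weight b is moved from y to y - κ at the price of 1/2.
  have hiter : ∀ (n : ℕ) y, ENNReal.ofReal (b (hatParam y)) * N (y - n * κ) y ≤
      ∑ k ∈ Finset.range n, (2⁻¹ : ℝ≥0∞) ^ k * h (y - k * κ) := by
    intro n
    induction n with
    | zero =>
      intro y
      have : G.tildeNorm ∅ f = 0 := by
        have := G.tildeNorm_const_mul MeasurableSet.empty 0 hf
        rw [zero_mul] at this
        rw [← this, RISpace.tildeNorm, RISpace.tildeNorm, indicator_empty, indicator_empty]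
      simp [hN, this]
    | succ n ih =>
      intro y
      have hunion : N (y - (n + 1 : ℕ) * κ) y ≤ N (y - κ - n * κ) (y - κ) + N (y - κ) y := by
        have : y - κ - n * κ = y - (n + 1 : ℕ) * κ := by push_cast; ring
        rw [this]
        exact G.tildeNorm_Ioo_le_add _ _ _ hf
      rw [Finset.sum_range_succ']
      calc ENNReal.ofReal (b (hatParam y)) * N (y - (n + 1 : ℕ) * κ) y
          ≤ ENNReal.ofReal (b (hatParam y)) * N (y - κ - n * κ) (y - κ) +
            ENNReal.ofReal (b (hatParam y)) * N (y - κ) y := by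
            rw [← mul_add]
            gcongr
        _ ≤ 2⁻¹ * (ENNReal.ofReal (b (hatParam (y - κ))) * N (y - κ - n * κ) (y - κ)) + h y := by
            rw [← mul_assoc]
            gcongr
            exacts [hbshift y, hstep y]
        _ ≤ 2⁻¹ * (∑ k ∈ Finset.range n, (2⁻¹ : ℝ≥0∞) ^ k * h (y - κ - k * κ)) + h y := by
            gcongr
            exact ih (y - κ)
        _ = _ := by
            rw [Finset.mul_sum]
            congr 1
            · refine Finset.sum_congr rfl fun k _ => ?_
              rw [pow_succ', mul_assoc]
              congr 3
              push_cast
              ring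
            · simp
  have hpt : ∀ y, outerProfile G b f (hatParam y) ≤
      ∑' k : ℕ, (2⁻¹ : ℝ≥0∞) ^ k * h (y - k * κ) := fun y => by
    rw [outerProfile, iSup_tildeNorm_hatParam G hf hκ, ENNReal.mul_iSup]
    exact iSup_le fun n => (hiter n y).trans (ENNReal.sum_le_tsum _)
  have htrans : ∀ k : ℕ, MeasurePreserving (fun y : ℝ => y - k * κ) volume volume := fun k =>
    measurePreserving_sub_right volume _
  have htm : ∀ k : ℕ, AEMeasurable (fun y => h (y - k * κ)) volume := fun k =>
    hhm.comp_quasiMeasurePreserving (htrans k).quasiMeasurePreserving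
  calc E.hatNorm (outerProfile G b f)
      = E.normOver volume (fun y => outerProfile G b f (hatParam y)) :=
        (E.normOver_comp measurePreserving_hatParam (aemeasurable_outerProfile G f hb)).symm
    _ ≤ E.normOver volume (fun y => ∑' k : ℕ, (2⁻¹ : ℝ≥0∞) ^ k * h (y - k * κ)) :=
        E.normOver_mono _ hpt
    _ ≤ ∑' k : ℕ, E.normOver volume (fun y => (2⁻¹ : ℝ≥0∞) ^ k * h (y - k * κ)) :=
        E.normOver_tsum_le lebesgueImage_volume fun k => (htm k).const_mul _
    -- All translates of h have the same norm, so only the geometric series is left.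
    _ = ∑' k : ℕ, (2⁻¹ : ℝ≥0∞) ^ k * E.normOver volume h := by
        congr 1
        ext k
        rw [E.normOver_const_mul lebesgueImage_volume _ (htm k), E.normOver_comp (htrans k) hhm]
    _ = 2 * (C * E.hatNorm (averagedProfile F G a b f)) := by
        have hnorm : E.normOver volume h = C * E.hatNorm (averagedProfile F G a b f) :=
          (E.normOver_const_mul lebesgueImage_volume _ hprof).trans (congrArg _
            (E.normOver_comp measurePreserving_hatParam (aemeasurable_averagedProfile F G f hb)))
        rw [ENNReal.tsum_mul_right, ENNReal.tsum_geometric, ENNReal.one_sub_inv_two, inv_inv,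
          hnorm]
    _ = _ := by
        rw [ENNReal.coe_mul, mul_assoc]
        rfl

end Profiles

theorem hatNorm_averagedProfile_le (E F G : RISpace) {a b : ℝ → ℝ}
    (ha : AEMeasurable a tildeMeasure) (f : ℝ → ℝ≥0∞) :
    E.hatNorm (averagedProfile F G a b f) ≤ E.hatNorm (outerProfile G b f) :=
  E.normOver_mono _ (averagedProfile_le_outerProfile F G f ha)

/-! ### Reflection `t ↦ 1 / t` -/

theorem RISpace.tildeNorm_inv (G : RISpace) {I J : Set ℝ} (hI : MeasurableSet I)
    (h : ∀ t > 0, t⁻¹ ∈ I ↔ t ∈ J) {f g : ℝ → ℝ≥0∞} (hf : AEMeasurable f tildeMeasure)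
    (hg : ∀ t > 0, t ∈ J → f t⁻¹ = g t) : G.tildeNorm I f = G.tildeNorm J g := by
  rw [tildeNorm, ← G.normOver_comp measurePreserving_inv_tildeMeasure (hf.indicator hI)]
  refine G.normOver_congr_ae ?_
  filter_upwards [ae_pos_tildeMeasure] with t ht
  by_cases hJ : t ∈ J
  · rw [indicator_of_mem ((h t ht).2 hJ), indicator_of_mem hJ, hg t ht hJ]
  · rw [indicator_of_notMem fun hI => hJ ((h t ht).1 hI), indicator_of_notMem hJ]

theorem inv_mem_Ioo_iff {p q t : ℝ} (ht : 0 < t) (hp : 0 < p) (hq : 0 < q) :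
    t⁻¹ ∈ Ioo p q ↔ t ∈ Ioo q⁻¹ p⁻¹ := by
  rw [mem_Ioo, mem_Ioo, lt_inv_comm₀ hp ht, inv_lt_comm₀ ht hq, and_comm]

theorem inv_mem_Ioi_iff {p t : ℝ} (ht : 0 < t) (hp : 0 < p) : t⁻¹ ∈ Ioi p ↔ t ∈ Ioo 0 p⁻¹ := by
  rw [mem_Ioi, mem_Ioo, lt_inv_comm₀ hp ht]
  simp [ht]

/-- Local comparability is all that the main estimate uses of slow variation besides measurability,
so it is what has to survive the reflection. -/
theorem LocallyComparable.comp_inv {b : ℝ → ℝ} (hb : LocallyComparable b) :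
    LocallyComparable fun t => b t⁻¹ := by
  refine ⟨fun t ht => hb.pos _ (inv_pos.2 ht), fun p q hp => ?_⟩
  rcases le_or_gt q 0 with hq | hq
  · exact ⟨1, one_pos, fun s hs => absurd (hs.1.trans hs.2) (by linarith)⟩
  obtain ⟨K, hK, h⟩ := hb.le_mul q⁻¹ p⁻¹ (inv_pos.2 hq)
  have hmem : ∀ s ∈ Icc p q, s⁻¹ ∈ Icc q⁻¹ p⁻¹ := fun s hs =>
    ⟨inv_anti₀ (hp.trans_le hs.1) hs.2, inv_anti₀ hp hs.1⟩
  exact ⟨K, hK, fun s hs t ht => h _ (hmem s hs) _ (hmem t ht)⟩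

theorem Equivalent.comp_inv_sq {a : ℝ → ℝ} (ha : Equivalent (fun t => a (t ^ 2)) a) :
    Equivalent (fun t => (fun s => a s⁻¹) (t ^ 2)) fun t => a t⁻¹ := by
  obtain ⟨C, hC, h⟩ := ha
  refine ⟨C, hC, fun t ht => ?_⟩
  simpa only [inv_pow] using h t⁻¹ (inv_pos.2 ht)

theorem assocZero_comp_inv (b : ℝ → ℝ) : assocZero (fun t => b t⁻¹) = assocInfty b := by
  ext u
  rw [assocZero, assocInfty, ← Real.exp_neg, neg_sub]

theorem assocInfty_comp_inv (b : ℝ → ℝ) : assocInfty (fun t => b t⁻¹) = assocZero b := by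
  ext u
  rw [assocZero, assocInfty, ← Real.exp_neg, neg_sub]

theorem RISpace.hatNorm_inv (E : RISpace) {g h : ℝ → ℝ≥0∞} (hg : AEMeasurable g hatMeasure)
    (hh : ∀ u > 0, h u = g u⁻¹) : E.hatNorm h = E.hatNorm g := by
  rw [hatNorm, hatNorm, ← E.normOver_comp measurePreserving_inv_hatMeasure hg]
  refine E.normOver_congr_ae ?_
  filter_upwards [ae_pos_hatMeasure] with u hu using hh u hu

theorem outerProfile_comp_inv (G : RISpace) (b : ℝ → ℝ) {f : ℝ → ℝ≥0∞}
    (hf : AEMeasurable f tildeMeasure) {u : ℝ} (hu : 0 < u) :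
    ENNReal.ofReal (b u) * G.tildeNorm (Ioi u) f =
      outerProfile G (fun t => b t⁻¹) (fun t => f t⁻¹) u⁻¹ := by
  rw [outerProfile, inv_inv, G.tildeNorm_inv measurableSet_Ioi
    (fun t ht => inv_mem_Ioi_iff ht hu) hf fun _ _ _ => rfl]

theorem averagedProfile_comp_inv (F G : RISpace) {a : ℝ → ℝ} (b : ℝ → ℝ)
    (ha : AEMeasurable a tildeMeasure) {f : ℝ → ℝ≥0∞} (hf : AEMeasurable f tildeMeasure)
    {u : ℝ} (hu : 0 < u) :
    ENNReal.ofReal (b u) / F.tildeNorm (Ioi u) (fun t => ENNReal.ofReal (a t)) *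
        F.tildeNorm (Ioi u) (fun t => ENNReal.ofReal (a t) * G.tildeNorm (Ioo u t) f) =
      averagedProfile F G (fun t => a t⁻¹) (fun t => b t⁻¹) (fun t => f t⁻¹) u⁻¹ := by
  have hm : Monotone fun t => G.tildeNorm (Ioo u t) f := fun s t h =>
    G.tildeNorm_mono_set (Ioo_subset_Ioo_right h) f
  have hI : ∀ t > 0, t⁻¹ ∈ Ioi u ↔ t ∈ Ioo 0 u⁻¹ := fun t ht => inv_mem_Ioi_iff ht hu
  have hprod : AEMeasurable (fun t => ENNReal.ofReal (a t) * G.tildeNorm (Ioo u t) f)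
      tildeMeasure := ha.ennreal_ofReal.mul hm.measurable.aemeasurable
  rw [averagedProfile, inv_inv, F.tildeNorm_inv measurableSet_Ioi hI ha.ennreal_ofReal
      (g := fun t => ENNReal.ofReal (a t⁻¹)) fun _ _ _ => rfl,
    F.tildeNorm_inv measurableSet_Ioi hI hprod
      (g := fun t => ENNReal.ofReal (a t⁻¹) * G.tildeNorm (Ioo t u⁻¹) fun s => f s⁻¹)]
  intro t ht _
  congr 1
  refine G.tildeNorm_inv measurableSet_Ioo (fun s hs => ?_) hf fun _ _ _ => rfl
  rw [inv_mem_Ioo_iff hs hu (inv_pos.2 ht), inv_inv]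

end RISpaces

/-! ### The two equivalences -/

open RISpaces in
theorem mainTheorem6 (E F G : RISpace) (a b : ℝ → ℝ)
    (ha : SlowlyVarying a) (hb : SlowlyVarying b)
    (ha2 : Equivalent (fun t => a (t ^ 2)) a) (hb2 : Equivalent (fun t => b (t ^ 2)) b) :
    (upperIndex (Ioo 0 1) (assocInfty a) < lowerIndex (Ioi 0) F.fundamental →
      upperIndex (Ioi 0) F.fundamental < lowerIndex (Ioo 0 1) (assocZero a) →
      upperIndex (Ioo 0 1) (assocZero b) < 0 → 0 < lowerIndex (Ioo 0 1) (assocInfty b) →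
      ∃ C : ℝ≥0, ∀ f : ℝ → ℝ≥0∞, AEMeasurable f lebMeasure →
        E.hatNorm (fun u => ENNReal.ofReal (b u) * G.tildeNorm (Ioo 0 u) f) ≤
          C * E.hatNorm (fun u =>
            ENNReal.ofReal (b u) / F.tildeNorm (Ioo 0 u) (fun t => ENNReal.ofReal (a t)) *
              F.tildeNorm (Ioo 0 u) (fun t => ENNReal.ofReal (a t) * G.tildeNorm (Ioo t u) f)) ∧
        E.hatNorm (fun u =>
            ENNReal.ofReal (b u) / F.tildeNorm (Ioo 0 u) (fun t => ENNReal.ofReal (a t)) *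
              F.tildeNorm (Ioo 0 u) (fun t => ENNReal.ofReal (a t) * G.tildeNorm (Ioo t u) f)) ≤
          C * E.hatNorm (fun u => ENNReal.ofReal (b u) * G.tildeNorm (Ioo 0 u) f)) ∧
    (upperIndex (Ioo 0 1) (assocZero a) < lowerIndex (Ioi 0) F.fundamental →
      upperIndex (Ioi 0) F.fundamental < lowerIndex (Ioo 0 1) (assocInfty a) →
      upperIndex (Ioo 0 1) (assocInfty b) < 0 → 0 < lowerIndex (Ioo 0 1) (assocZero b) →
      ∃ C : ℝ≥0, ∀ f : ℝ → ℝ≥0∞, AEMeasurable f lebMeasure →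
        E.hatNorm (fun u => ENNReal.ofReal (b u) * G.tildeNorm (Ioi u) f) ≤
          C * E.hatNorm (fun u =>
            ENNReal.ofReal (b u) / F.tildeNorm (Ioi u) (fun t => ENNReal.ofReal (a t)) *
              F.tildeNorm (Ioi u) (fun t => ENNReal.ofReal (a t) * G.tildeNorm (Ioo u t) f)) ∧
        E.hatNorm (fun u =>
            ENNReal.ofReal (b u) / F.tildeNorm (Ioi u) (fun t => ENNReal.ofReal (a t)) *
              F.tildeNorm (Ioi u) (fun t => ENNReal.ofReal (a t) * G.tildeNorm (Ioo u t) f)) ≤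
          C * E.hatNorm (fun u => ENNReal.ofReal (b u) * G.tildeNorm (Ioi u) f)) := by
  have hat : AEMeasurable a tildeMeasure := ha.aemeasurable.mono_ac tildeMeasure_absolutelyContinuous
  have hbh : AEMeasurable b hatMeasure := hb.aemeasurable.mono_ac hatMeasure_absolutelyContinuous
  have hal := ha.locallyComparable
  have hbl := hb.locallyComparable
  constructor
  · intro _ hF hb0 hbi
    obtain ⟨C, hC⟩ := hatNorm_outerProfile_le F G E hat hbh hal hbl ha2 hF hb0 hbi
    refine ⟨max 1 C, fun f hf => ⟨?_, ?_⟩⟩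
    · refine (hC f (hf.mono_ac tildeMeasure_absolutelyContinuous)).trans ?_
      exact mul_le_mul' (by exact_mod_cast le_max_right _ _) le_rfl
    · refine (hatNorm_averagedProfile_le E F G hat f).trans ?_
      exact le_mul_of_one_le_left zero_le (by exact_mod_cast le_max_left _ _)
  · intro _ hF hbi hb0
    have hat' : AEMeasurable (fun t => a t⁻¹) tildeMeasure :=
      hat.comp_quasiMeasurePreserving measurePreserving_inv_tildeMeasure.quasiMeasurePreserving
    have hbh' : AEMeasurable (fun t => b t⁻¹) hatMeasure :=
      hbh.comp_quasiMeasurePreserving measurePreserving_inv_hatMeasure.quasiMeasurePreserving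
    obtain ⟨C, hC⟩ := hatNorm_outerProfile_le F G E hat' hbh' hal.comp_inv hbl.comp_inv
      ha2.comp_inv_sq (by rwa [assocZero_comp_inv]) (by rwa [assocZero_comp_inv])
      (by rwa [assocInfty_comp_inv])
    refine ⟨max 1 C, fun f hf => ?_⟩
    have hft := hf.mono_ac tildeMeasure_absolutelyContinuous
    rw [E.hatNorm_inv (aemeasurable_outerProfile G (fun t => f t⁻¹) hbh')
        fun u hu => outerProfile_comp_inv G b hft hu,
      E.hatNorm_inv (aemeasurable_averagedProfile F G (a := fun t => a t⁻¹) (fun t => f t⁻¹) hbh')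
        fun u hu => averagedProfile_comp_inv F G b hat hft hu]
    constructor
    · refine (hC _ (hft.comp_quasiMeasurePreserving
        measurePreserving_inv_tildeMeasure.quasiMeasurePreserving)).trans ?_
      exact mul_le_mul' (by exact_mod_cast le_max_right _ _) le_rfl
    · refine (hatNorm_averagedProfile_le E F G hat' _).trans ?_
      exact le_mul_of_one_le_left zero_le (by exact_mod_cast le_max_left _ _)
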